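/- \textbf{Theorem (Left Azumaya algebras).} Let $(\mathcal V,\otimes,I,\tau)$ be a braided monoidal category (associativity and unit isomorphisms are suppressed below) and let $\mathcal A=(A,m,e)$ be an algebra (monoid) in $\mathcal V$. \emph{Notation.} $\mathcal A^\tau=(A,\,m\cdot\tau_{A,A},\,e)$ is the opposite algebra, and $\mathcal A^e=\mathcal A\otimes\mathcal A^\tau$ is the braided tensor product algebra, with multiplication $(m\otimes m\tau_{A,A})(A\otimes\tau_{A,A}\otimes A)$ and unit $e\otimes e$. For an algebra $\mathcal B=(B,m_B,e_B)$, $\mathcal B_l$ is the monad $B\otimes-$ on $\mathcal V$; its Eilenberg--Moore category is the category ${}_{\mathcal B}\mathcal V$ of left $\mathcal B$-modules, with free functor $\phi_{\mathcal B_l}:\mathcal V\to{}_{\mathcal B}\mathcal V$, $V\mapsto(B\otimes V,\,m_B\otimes V)$. The transformation $\lambda=\tau_{A,A}\otimes-$ is a distributive law of $(\mathcal A^\tau)_l$ over $\mathcal A_l$ that satisfies the Yang--Baxter equation, and the composite monad $\mathcal A_l(\mathcal A^\tau)_l$ is identified with $(\mathcal A^e)_l$. The algebra $\mathcal A$ is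 \emph{left Azumaya} if the comparison functor $$\overline K_l:\mathcal V\to\mathcal V_{\mathcal A_l(\mathcal A^\tau)_l}={}_{\mathcal A^e}\mathcal V,\qquad V\mapsto\bigl(A\otimes V,\ A\otimes A\otimes A\otimes V\xrightarrow{A\otimes m\tau_{A,A}\otimes V}A\otimes A\otimes V\xrightarrow{m\otimes V}A\otimes V\bigr)$$ is an equivalence of categories. The action displayed here is a left $(\mathcal A^e)_l$-module structure $\alpha$ on the functor $A\otimes-$. For a monad $T$ on $\mathcal V$, a $T$-module functor $(R:\mathcal V\to\mathcal V,\ \alpha:TR\to R)$ is \emph{Galois} if $R$ has a left adjoint $L$, with unit $\eta:1\to RL$, and $T\xrightarrow{T\eta}TRL\xrightarrow{\alpha L}RL$ is an isomorphism. A functor is \emph{monadic} (\emph{comonadic}) if it has a left (right) adjoint and the associated Eilenberg--Moore comparison functor is an equivalence. A \emph{left dual} of $A$ is an object $A^*$ with morphisms $\mathrm{db}:I\to A\otimes A^*$ and $\mathrm{ev}:A^*\otimes A\to I$ satisfying the triangle identities; $\mathcal S_{A,A^*}$ is then the algebra $A\otimes A^*$ with multiplication $A\otimes\mathrm{ev}\otimes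 A^*$ and unit $\mathrm{db}$. A \emph{right dual} of $A$ is an object $A^\sharp$ with morphisms $\mathrm{db}':I\to A^\sharp\otimes A$ and $\mathrm{ev}':A\otimes A^\sharp\to I$ satisfying the triangle identities. \emph{The following are equivalent:} \begin{enumerate} \item[(a)] $\mathcal A$ is left Azumaya; \item[(b)] the functor $A\otimes-:\mathcal V\to\mathcal V$ is monadic and the left $(\mathcal A^e)_l$-module structure $\alpha$ on it is Galois; \item[(c)] the functor $A\otimes-:\mathcal V\to\mathcal V$ is monadic, and $A$ has a left dual $(A^*,\mathrm{db},\mathrm{ev})$ such that the composite $$\overline\chi_0:\ A\otimes A\xrightarrow{A\otimes A\otimes\mathrm{db}}A\otimes A\otimes A\otimes A^*\xrightarrow{A\otimes\tau_{A,A}\otimes A^*}A\otimes A\otimes A\otimes A^*\xrightarrow{m\otimes A\otimes A^*}A\otimes A\otimes A^*\xrightarrow{m\otimes A^*}A\otimes A^*$$ is an isomorphism of algebras $\mathcal A^e\to\mathcal S_{A,A^*}$; \item[(d)] the free functor $\phi_{(\mathcal A^\tau)_l}:\mathcal V\to{}_{\mathcal A^\tau}\mathcal V$ is comonadic, and $A$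 has a right dual $(A^\sharp,\mathrm{db}',\mathrm{ev}')$ such that the composite $$\overline\chi:\ A\otimes A\xrightarrow{\mathrm{db}'\otimes A\otimes A}A^\sharp\otimes A\otimes A\otimes A\xrightarrow{A^\sharp\otimes m\otimes A}A^\sharp\otimes A\otimes A\xrightarrow{A^\sharp\otimes\tau_{A,A}}A^\sharp\otimes A\otimes A\xrightarrow{A^\sharp\otimes m}A^\sharp\otimes A$$ is an isomorphism. \end{enumerate} -/

import Mathlib

open CategoryTheory MonoidalCategory

universe v u v' u'

namespace AzumayaCat

section Monads

variable {C : Type u} [Category.{v} C] {D : Type u'} [Category.{v'} D]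

/-- A distributive law `λ : TS ⟶ ST` of a monad `T` over a monad `S`
(`TS` is `X ↦ T (S X)`, i.e. `S ⋙ T` in diagrammatic order). -/
structure DistributiveLaw (T S : Monad C) where
  hom : S.toFunctor ⋙ T.toFunctor ⟶ T.toFunctor ⋙ S.toFunctor
  unit_left : ∀ X : C, T.η.app (S.obj X) ≫ hom.app X = S.map (T.η.app X)
  unit_right : ∀ X : C, T.map (S.η.app X) ≫ hom.app X = S.η.app (T.obj X)
  mul_right : ∀ X : C, T.map (S.μ.app X) ≫ hom.app X =
    hom.app (S.obj X) ≫ S.map (hom.app X) ≫ S.μ.app (T.obj X)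
  mul_left : ∀ X : C, T.μ.app (S.obj X) ≫ hom.app X =
    T.map (hom.app X) ≫ hom.app (T.obj X) ≫ S.map (T.μ.app X)

theorem DistributiveLaw.nat {T S : Monad C} (l : DistributiveLaw T S) {X Y : C} (f : X ⟶ Y) :
    T.map (S.map f) ≫ l.hom.app Y = l.hom.app X ≫ S.map (T.map f) :=
  l.hom.naturality f

/-- The composite monad `ST` with multiplication `m_S m_T · S λ T` and unit `e_S e_T`. -/
def DistributiveLaw.composite {T S : Monad C} (l : DistributiveLaw T S) : Monad C where
  toFunctor := T.toFunctor ⋙ S.toFunctor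
  η :=
    { app := fun X => T.η.app X ≫ S.η.app (T.obj X)
      naturality := fun X Y f => by
        have h1 := T.η.naturality f
        have h2 := S.η.naturality (T.map f)
        simp only [Functor.id_map, Functor.id_obj, Functor.comp_map] at h1 h2 ⊢
        rw [reassoc_of% h1, h2, Category.assoc] }
  μ :=
    { app := fun X => S.map (l.hom.app (T.obj X)) ≫ S.map (S.map (T.μ.app X)) ≫
        S.μ.app (T.obj X)
      naturality := fun X Y f => by
        have h1 := l.nat (T.map f)
        have h2 := T.μ.naturality f
        have h3 := S.μ.naturality (T.map f)
        simp only [Functor.comp_map, Category.assoc, Functor.comp_obj] at h1 h2 h3 ⊢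
        rw [← h3, ← S.map_comp_assoc, h1, S.map_comp_assoc, ← S.map_comp_assoc (S.map _),
          ← S.map_comp, h2, S.map_comp, S.map_comp_assoc] }
  assoc := fun X => by
    have h1 := congrArg S.map (l.mul_right (T.obj X))
    have h2 := congrArg (fun f => S.map (S.map f)) (l.mul_left (T.obj X))
    have h3 := congrArg S.map (l.nat (l.hom.app (T.obj X)))
    have h4 := congrArg S.map (l.nat (S.map (T.μ.app X)))
    have h5 := S.μ.naturality (l.hom.app (T.obj X))
    have h6 := S.μ.naturality (S.map (T.μ.app X))
    have h7 := congrArg (fun f => S.map (S.map f)) (l.nat (T.μ.app X))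
    have h8 := congrArg (fun f => S.map (S.map (S.map f))) (T.assoc X)
    have h9 := S.assoc (T.obj X)
    have h10 := congrArg S.map (S.μ.naturality (T.μ.app X))
    simp only [Functor.comp_obj, Functor.comp_map, Functor.map_comp, Category.assoc]
      at h1 h2 h3 h4 h5 h6 h7 h8 h9 h10 ⊢
    rw [reassoc_of% h1, reassoc_of% h4, reassoc_of% h3, ← reassoc_of% h5, reassoc_of% h2,
      ← reassoc_of% h6, ← h9, ← reassoc_of% h10, reassoc_of% h7, reassoc_of% h8]
  left_unit := fun X => by
    have h1 := S.η.naturality (l.hom.app (T.obj X))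
    have h2 := S.η.naturality (S.map (T.μ.app X))
    have h3 := l.unit_left (T.obj X)
    simp only [Functor.comp_obj, Functor.id_map, Functor.id_obj, Category.assoc] at h1 h2 h3 ⊢
    rw [← reassoc_of% h1, reassoc_of% h3, ← reassoc_of% h2, S.left_unit]
    erw [Category.comp_id]
    rw [← S.map_comp, T.left_unit]
    exact S.map_id _
  right_unit := fun X => by
    have h1 := congrArg S.map (l.unit_right (T.obj X))
    have h2 := congrArg S.map (S.η.naturality (T.μ.app X))
    simp only [Functor.comp_obj, Functor.comp_map, Functor.id_map, Functor.id_obj,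
      Functor.map_comp, Category.assoc] at h1 h2 ⊢
    rw [reassoc_of% h1, ← reassoc_of% h2, S.right_unit]
    erw [Category.comp_id]
    rw [← S.map_comp, T.right_unit]
    exact S.map_id _

/-- A BD-law on a monad `F`: a distributive law `λ : FF ⟶ FF` of `F` over itself that satisfies
the Yang-Baxter equation. -/
structure BDLaw (F : Monad C) extends DistributiveLaw F F where
  yang_baxter : ∀ X : C,
    F.map (hom.app X) ≫ hom.app (F.obj X) ≫ F.map (hom.app X) =
      hom.app (F.obj X) ≫ F.map (hom.app X) ≫ hom.app (F.obj X)

/-- The opposite monad `F^λ = (F, m · λ, e)`. -/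
def BDLaw.opposite {F : Monad C} (l : BDLaw F) : Monad C where
  toFunctor := F.toFunctor
  η := F.η
  μ := l.hom ≫ F.μ
  assoc := fun X => by
    have h1 := l.mul_right X
    have h2 := l.mul_left X
    have h3 := l.yang_baxter X
    simp only [NatTrans.comp_app, Functor.comp_obj, Functor.map_comp, Category.assoc]
      at h1 h2 h3 ⊢
    rw [reassoc_of% h1, reassoc_of% h2, reassoc_of% h3, F.assoc]
  left_unit := fun X => by
    have h := l.unit_left X
    simp only [NatTrans.comp_app, Functor.comp_obj] at h ⊢
    rw [reassoc_of% h, F.right_unit]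
    rfl
  right_unit := fun X => by
    have h := l.unit_right X
    simp only [NatTrans.comp_app, Functor.comp_obj] at h ⊢
    rw [reassoc_of% h, F.left_unit]
    rfl

/-- The law `λ`, regarded as a distributive law of `F^λ` over `F`. -/
def BDLaw.oppositeLaw {F : Monad C} (l : BDLaw F) : DistributiveLaw l.opposite F where
  hom := l.hom
  unit_left := l.unit_left
  unit_right := l.unit_right
  mul_right := l.mul_right
  mul_left := fun X => by
    have h2 := l.mul_left X
    have h3 := l.yang_baxter X
    simp only [BDLaw.opposite, NatTrans.comp_app, Functor.comp_obj, Functor.map_comp,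
      Category.assoc] at h2 h3 ⊢
    rw [h2, reassoc_of% h3]

/-- The monad `F F^λ`. -/
def BDLaw.enveloping {F : Monad C} (l : BDLaw F) : Monad C := l.oppositeLaw.composite

/-- A left `T`-module structure on a functor `R : D ⥤ C`: a natural transformation
`act : TR ⟶ R` that is unital and associative. -/
structure ModuleFunctor (T : Monad C) (R : D ⥤ C) where
  act : R ⋙ T.toFunctor ⟶ R
  unit : ∀ X : D, T.η.app (R.obj X) ≫ act.app X = 𝟙 (R.obj X)
  assoc : ∀ X : D, T.μ.app (R.obj X) ≫ act.app X = T.map (act.app X) ≫ act.app X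

/-- The functor `D ⥤ C_T`, `X ↦ (R X, act_X)`, into the Eilenberg-Moore category. -/
def ModuleFunctor.lift {T : Monad C} {R : D ⥤ C} (M : ModuleFunctor T R) : D ⥤ T.Algebra where
  obj X :=
    { A := R.obj X
      a := M.act.app X
      unit := M.unit X
      assoc := M.assoc X }
  map f :=
    { f := R.map f
      h := M.act.naturality f }

/-- For an adjunction `L ⊣ R`, the transformation `T ⟶ TRL ⟶ RL`,
from `T` to the monad generated by the adjunction. -/
def ModuleFunctor.toAdjunctionMonad {T : Monad C} {R : D ⥤ C} (M : ModuleFunctor T R)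
    {L : C ⥤ D} (adj : L ⊣ R) : T.toFunctor ⟶ L ⋙ R where
  app X := T.map (adj.unit.app X) ≫ M.act.app (L.obj X)
  naturality X Y f := by
    have h1 := M.act.naturality (L.map f)
    have h2 := adj.unit.naturality f
    simp only [Functor.comp_obj, Functor.comp_map, Functor.id_obj, Functor.id_map,
      Category.assoc] at h1 h2 ⊢
    rw [← h1, ← T.map_comp_assoc, h2, T.map_comp_assoc]

/-- A `T`-module functor is Galois if it has a left adjoint and the induced morphism from `T`
to the monad of the adjunction is invertible (this does not depend on the left adjoint). -/
def ModuleFunctor.IsGalois {T : Monad C} {R : D ⥤ C} (M : ModuleFunctor T R) : Prop :=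
  ∃ (L : C ⥤ D) (adj : L ⊣ R), IsIso (M.toAdjunctionMonad adj)

/-- The left `F F^λ`-module structure `m · F m · F λ` on the functor `F`. -/
def BDLaw.moduleFunctor {F : Monad C} (l : BDLaw F) :
    ModuleFunctor l.enveloping F.toFunctor where
  act :=
    { app := fun X => F.map (l.hom.app X) ≫ F.map (F.μ.app X) ≫ F.μ.app X
      naturality := fun X Y f => by
        have h1 := congrArg F.map (l.nat f)
        have h2 := congrArg F.map (F.μ.naturality f)
        have h3 := F.μ.naturality f
        simp only [BDLaw.enveloping, DistributiveLaw.composite, BDLaw.opposite,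
          Functor.comp_obj, Functor.comp_map, Functor.map_comp, Category.assoc] at h1 h2 h3 ⊢
        rw [reassoc_of% h1, reassoc_of% h2, h3] }
  unit := fun X => by
    have h1 := F.η.naturality (l.hom.app X)
    have h2 := F.η.naturality (F.μ.app X)
    have h3 := l.unit_left X
    simp only [BDLaw.enveloping, DistributiveLaw.composite, BDLaw.opposite,
      Functor.comp_obj, Functor.id_obj, Functor.id_map, Category.assoc] at h1 h2 h3 ⊢
    rw [← reassoc_of% h1, ← reassoc_of% h2, reassoc_of% h3, F.left_unit]
    erw [Category.comp_id]
    rw [F.right_unit]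
    rfl
  assoc := fun X => by
    have h1 := congrArg F.map (l.mul_right X)
    have h2 := congrArg F.map (l.nat (l.hom.app X))
    have h3 := congrArg F.map (l.nat (F.μ.app X))
    have h4 := F.μ.naturality (l.hom.app X)
    have h5 := F.μ.naturality (F.μ.app X)
    have h6 := congrArg (fun f => F.map (F.map f)) (l.opposite.assoc X)
    have h7 := congrArg F.map (F.assoc X)
    have h8 := F.assoc X
    simp only [BDLaw.enveloping, DistributiveLaw.composite, BDLaw.opposite, BDLaw.oppositeLaw,
      NatTrans.comp_app, Functor.comp_obj, Functor.comp_map, Functor.map_comp, Category.assoc]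
      at h1 h2 h3 h4 h5 h6 h7 h8 ⊢
    rw [reassoc_of% h1, reassoc_of% h3, reassoc_of% h2, ← reassoc_of% h4, ← reassoc_of% h5,
      ← h8, ← reassoc_of% h6, ← reassoc_of% h7]

/-- The comparison functor `C ⥤ C_{F F^λ}`, `X ↦ (F X, m · F m · F λ)`. -/
def BDLaw.comparison {F : Monad C} (l : BDLaw F) : C ⥤ l.enveloping.Algebra :=
  l.moduleFunctor.lift

/-- The monad `F` is Azumaya with respect to the BD-law `λ`. -/
def BDLaw.IsAzumaya {F : Monad C} (l : BDLaw F) : Prop := l.comparison.IsEquivalence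

/-- A functor is monadic if it has a left adjoint for which the comparison functor into the
Eilenberg-Moore category is an equivalence. -/
def IsMonadic (R : D ⥤ C) : Prop := Nonempty (MonadicRightAdjoint R)

/-- A functor is comonadic if it has a right adjoint for which the comparison functor into the
category of coalgebras is an equivalence. -/
def IsComonadic (L : C ⥤ D) : Prop := Nonempty (ComonadicLeftAdjoint L)

end Monads

section Algebras

variable {V : Type u} [Category.{v} V] [MonoidalCategory V]

theorem leftAction_assoc (B A X : V) (r : B ⊗ A ⟶ A) (k : B ⊗ B ⟶ B)
    (h : k ▷ A ≫ r = (α_ B B A).hom ≫ B ◁ r ≫ r) :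
    ((α_ B B (A ⊗ X)).inv ≫ k ▷ (A ⊗ X)) ≫ (α_ B A X).inv ≫ r ▷ X =
      B ◁ ((α_ B A X).inv ≫ r ▷ X) ≫ (α_ B A X).inv ≫ r ▷ X := by
  calc _ = 𝟙 _ ⊗≫ (k ▷ A ≫ r) ▷ X := by monoidal
    _ = _ := by rw [h]; monoidal

theorem leftAction_unit (B A X : V) (r : B ⊗ A ⟶ A) (k : 𝟙_ V ⟶ B)
    (h : k ▷ A ≫ r = (λ_ A).hom) :
    ((λ_ (A ⊗ X)).inv ≫ k ▷ (A ⊗ X)) ≫ (α_ B A X).inv ≫ r ▷ X = 𝟙 (A ⊗ X) := by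
  calc _ = 𝟙 _ ⊗≫ (k ▷ A ≫ r) ▷ X := by monoidal
    _ = _ := by rw [h]; monoidal

/-- The monad `A ⊗ -` of an algebra `A`. Its Eilenberg-Moore category is the category of left
`A`-modules, and its free functor is the free module functor. -/
def leftMonad (A : Mon V) : Monad V where
  toFunctor := tensorLeft A.X
  η :=
    { app := fun X => (λ_ X).inv ≫ MonObj.one (X := A.X) ▷ X
      naturality := fun X Y f => by simp [← whisker_exchange] }
  μ :=
    { app := fun X => (α_ A.X A.X X).inv ≫ MonObj.mul (X := A.X) ▷ X
      naturality := fun X Y f => by simp [← whisker_exchange] }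
  assoc := fun X => (leftAction_assoc A.X A.X X _ _ (MonObj.mul_assoc A.X)).symm
  left_unit := fun X => leftAction_unit A.X A.X X _ _ (MonObj.one_mul A.X)
  right_unit := fun X => by
    change A.X ◁ ((λ_ X).inv ≫ MonObj.one (X := A.X) ▷ X) ≫
      (α_ A.X A.X X).inv ≫ MonObj.mul (X := A.X) ▷ X = 𝟙 (A.X ⊗ X)
    calc _ = 𝟙 _ ⊗≫ (A.X ◁ MonObj.one (X := A.X) ≫ MonObj.mul (X := A.X)) ▷ X := by monoidal
      _ = _ := by rw [MonObj.mul_one]; monoidal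

/-- For a left dual `W*` of `W`, with unit `db : I ⟶ W ⊗ W*` and counit `ev : W* ⊗ W ⟶ I`, the
algebra `W ⊗ W*` with multiplication `W ⊗ ev ⊗ W*` and unit `db`. -/
def dualAlgebra (W Wstar : V) [ExactPairing W Wstar] : Mon V where
  X := W ⊗ Wstar
  mon :=
    { one := η_ W Wstar
      mul := (α_ W Wstar (W ⊗ Wstar)).hom ≫ W ◁ (α_ Wstar W Wstar).inv ≫
        W ◁ (ε_ W Wstar ▷ Wstar) ≫ W ◁ (λ_ Wstar).hom
      one_mul := by
        calc _ = 𝟙 _ ⊗≫ (η_ W Wstar ▷ W ≫ (α_ _ _ _).hom ≫ W ◁ ε_ _ Wstar) ▷ Wstar ⊗≫ 𝟙 _ := by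
              monoidal
          _ = _ := by rw [ExactPairing.evaluation_coevaluation]; monoidal
      mul_one := by
        calc _ = 𝟙 _ ⊗≫ W ◁ (Wstar ◁ η_ W Wstar ≫ (α_ _ _ _).inv ≫ ε_ W _ ▷ Wstar) ⊗≫ 𝟙 _ := by
              monoidal
          _ = _ := by rw [ExactPairing.coevaluation_evaluation]; monoidal
      mul_assoc := by
        generalize ε_ W Wstar = e
        calc _ = 𝟙 _ ⊗≫ W ◁ ((e ▷ (Wstar ⊗ W) ≫ _ ◁ e) ▷ Wstar) ⊗≫ 𝟙 _ := by monoidal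
          _ = _ := by rw [← whisker_exchange]; monoidal }

theorem envelopingAction_unit (A : V) (m n : A ⊗ A ⟶ A) (e : 𝟙_ V ⟶ A)
    (hm : e ▷ A ≫ m = (λ_ A).hom) (hn : e ▷ A ≫ n = (λ_ A).hom) :
    ((λ_ (𝟙_ V)).inv ≫ (e ⊗ₘ e)) ▷ A ≫ (α_ A A A).hom ≫ A ◁ n ≫ m = (λ_ A).hom := by
  calc _ = 𝟙 _ ⊗≫ e ▷ (𝟙_ V ⊗ A) ⊗≫ A ◁ (e ▷ A ≫ n) ≫ m := by
        rw [MonoidalCategory.tensorHom_def]; monoidal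
    _ = 𝟙 _ ⊗≫ (e ▷ A ≫ m) := by rw [hn]; monoidal
    _ = _ := by rw [hm]; monoidal

variable [BraidedCategory V]

theorem mul_braiding_right (A : V) (m : A ⊗ A ⟶ A) :
    A ◁ m ≫ (β_ A A).hom = (α_ A A A).inv ≫ (β_ A A).hom ▷ A ≫ (α_ A A A).hom ≫
      A ◁ (β_ A A).hom ≫ (α_ A A A).inv ≫ m ▷ A := by
  simp

theorem mul_braiding_left (A : V) (m : A ⊗ A ⟶ A) :
    m ▷ A ≫ (β_ A A).hom = (α_ A A A).hom ≫ A ◁ (β_ A A).hom ≫ (α_ A A A).inv ≫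
      (β_ A A).hom ▷ A ≫ (α_ A A A).hom ≫ A ◁ m := by
  simp

theorem opposite_mul_assoc (A : V) (m : A ⊗ A ⟶ A)
    (h : m ▷ A ≫ m = (α_ A A A).hom ≫ A ◁ m ≫ m) :
    ((β_ A A).hom ≫ m) ▷ A ≫ (β_ A A).hom ≫ m =
      (α_ A A A).hom ≫ A ◁ ((β_ A A).hom ≫ m) ≫ (β_ A A).hom ≫ m := by
  have hyb := BraidedCategory.yang_baxter A A A
  simp only [comp_whiskerRight, whiskerLeft_comp, Category.assoc,
    BraidedCategory.braiding_naturality_left_assoc,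
    BraidedCategory.braiding_naturality_right_assoc,
    BraidedCategory.braiding_tensor_left_hom, BraidedCategory.braiding_tensor_right_hom, h]
  simp only [Iso.inv_hom_id_assoc, Iso.hom_inv_id_assoc, ← reassoc_of% hyb]

/-- The opposite algebra `A^τ = (A, m · τ, e)`. -/
def oppositeAlgebra (A : Mon V) : Mon V where
  X := A.X
  mon :=
    { one := MonObj.one (X := A.X)
      mul := (β_ A.X A.X).hom ≫ MonObj.mul (X := A.X)
      one_mul := by simp
      mul_one := by simp
      mul_assoc := opposite_mul_assoc A.X _ (MonObj.mul_assoc A.X) }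

/-- The algebra `A^e`: the braided tensor product of `A` with its opposite algebra. -/
def envelopingAlgebra (A : Mon V) : Mon V := A ⊗ oppositeAlgebra A

theorem braidingLaw_unit_left (A X : V) (e : 𝟙_ V ⟶ A) :
    ((λ_ (A ⊗ X)).inv ≫ e ▷ (A ⊗ X)) ≫
        (α_ A A X).inv ≫ (β_ A A).hom ▷ X ≫ (α_ A A X).hom =
      A ◁ ((λ_ X).inv ≫ e ▷ X) := by
  calc _ = 𝟙 _ ⊗≫ (e ▷ A ≫ (β_ A A).hom) ▷ X ⊗≫ 𝟙 _ := by monoidal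
    _ = _ := by
      rw [BraidedCategory.braiding_naturality_left, braiding_tensorUnit_left]; monoidal

theorem braidingLaw_unit_right (A X : V) (e : 𝟙_ V ⟶ A) :
    A ◁ ((λ_ X).inv ≫ e ▷ X) ≫
        (α_ A A X).inv ≫ (β_ A A).hom ▷ X ≫ (α_ A A X).hom =
      (λ_ (A ⊗ X)).inv ≫ e ▷ (A ⊗ X) := by
  calc _ = 𝟙 _ ⊗≫ (A ◁ e ≫ (β_ A A).hom) ▷ X ⊗≫ 𝟙 _ := by monoidal
    _ = _ := by
      rw [BraidedCategory.braiding_naturality_right, braiding_tensorUnit_right]; monoidal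

theorem braidingLaw_mul_right (A X : V) (m : A ⊗ A ⟶ A) :
    A ◁ ((α_ A A X).inv ≫ m ▷ X) ≫ (α_ A A X).inv ≫ (β_ A A).hom ▷ X ≫ (α_ A A X).hom =
      ((α_ A A (A ⊗ X)).inv ≫ (β_ A A).hom ▷ (A ⊗ X) ≫ (α_ A A (A ⊗ X)).hom) ≫
        A ◁ ((α_ A A X).inv ≫ (β_ A A).hom ▷ X ≫ (α_ A A X).hom) ≫
          (α_ A A (A ⊗ X)).inv ≫ m ▷ (A ⊗ X) := by
  calc _ = 𝟙 _ ⊗≫ (A ◁ m ≫ (β_ A A).hom) ▷ X ⊗≫ 𝟙 _ := by monoidal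
    _ = _ := by rw [mul_braiding_right]; monoidal

theorem braidingLaw_mul_left (A X : V) (m : A ⊗ A ⟶ A) :
    ((α_ A A (A ⊗ X)).inv ≫ m ▷ (A ⊗ X)) ≫
        (α_ A A X).inv ≫ (β_ A A).hom ▷ X ≫ (α_ A A X).hom =
      A ◁ ((α_ A A X).inv ≫ (β_ A A).hom ▷ X ≫ (α_ A A X).hom) ≫
        ((α_ A A (A ⊗ X)).inv ≫ (β_ A A).hom ▷ (A ⊗ X) ≫ (α_ A A (A ⊗ X)).hom) ≫
          A ◁ ((α_ A A X).inv ≫ m ▷ X) := by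
  calc _ = 𝟙 _ ⊗≫ (m ▷ A ≫ (β_ A A).hom) ▷ X ⊗≫ 𝟙 _ := by monoidal
    _ = _ := by rw [mul_braiding_left]; monoidal

theorem braidingLaw_yang_baxter (A X : V) :
    A ◁ ((α_ A A X).inv ≫ (β_ A A).hom ▷ X ≫ (α_ A A X).hom) ≫
        ((α_ A A (A ⊗ X)).inv ≫ (β_ A A).hom ▷ (A ⊗ X) ≫ (α_ A A (A ⊗ X)).hom) ≫
          A ◁ ((α_ A A X).inv ≫ (β_ A A).hom ▷ X ≫ (α_ A A X).hom) =
      ((α_ A A (A ⊗ X)).inv ≫ (β_ A A).hom ▷ (A ⊗ X) ≫ (α_ A A (A ⊗ X)).hom) ≫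
        A ◁ ((α_ A A X).inv ≫ (β_ A A).hom ▷ X ≫ (α_ A A X).hom) ≫
          ((α_ A A (A ⊗ X)).inv ≫ (β_ A A).hom ▷ (A ⊗ X) ≫ (α_ A A (A ⊗ X)).hom) := by
  have hyb := BraidedCategory.yang_baxter A A A
  have h : A ◁ (β_ A A).hom ≫ (α_ A A A).inv ≫ (β_ A A).hom ▷ A ≫ (α_ A A A).hom ≫
      A ◁ (β_ A A).hom = ((α_ A A A).inv ≫ (β_ A A).hom ▷ A ≫ (α_ A A A).hom ≫
        A ◁ (β_ A A).hom ≫ (α_ A A A).inv ≫ (β_ A A).hom ▷ A) ≫ (α_ A A A).hom := by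
    simp [← hyb]
  calc _ = 𝟙 _ ⊗≫ (A ◁ (β_ A A).hom ≫ (α_ A A A).inv ≫ (β_ A A).hom ▷ A ≫
          (α_ A A A).hom ≫ A ◁ (β_ A A).hom) ▷ X ⊗≫ 𝟙 _ := by monoidal
    _ = _ := by rw [h]; monoidal

/-- The BD-law on the monad `A ⊗ -` given by `τ_{A,A} ⊗ -`. -/
def braidingLaw (A : Mon V) : BDLaw (leftMonad A) where
  hom :=
    { app := fun X => (α_ A.X A.X X).inv ≫ (β_ A.X A.X).hom ▷ X ≫ (α_ A.X A.X X).hom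
      naturality := fun X Y f => by
        change A.X ◁ (A.X ◁ f) ≫ (α_ A.X A.X Y).inv ≫ (β_ A.X A.X).hom ▷ Y ≫
            (α_ A.X A.X Y).hom =
          ((α_ A.X A.X X).inv ≫ (β_ A.X A.X).hom ▷ X ≫ (α_ A.X A.X X).hom) ≫
            A.X ◁ (A.X ◁ f)
        have h := whisker_exchange (β_ A.X A.X).hom f
        simp only [Category.assoc, ← associator_naturality_right, ← reassoc_of% h]
        simp }
  unit_left := fun X => braidingLaw_unit_left A.X X _
  unit_right := fun X => braidingLaw_unit_right A.X X _
  mul_right := fun X => braidingLaw_mul_right A.X X _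
  mul_left := fun X => braidingLaw_mul_left A.X X _
  yang_baxter := fun X => braidingLaw_yang_baxter A.X X

/-- `A` is left Azumaya: the monad `A ⊗ -` is Azumaya with respect to the BD-law
`τ_{A,A} ⊗ -`, i.e. the comparison functor
`X ↦ (A ⊗ X, A ⊗ A ⊗ A ⊗ X ⟶ A ⊗ A ⊗ X ⟶ A ⊗ X)` is an equivalence. -/
def IsLeftAzumaya (A : Mon V) : Prop := (braidingLaw A).IsAzumaya

theorem envelopingAction_assoc (A : V) (m n : A ⊗ A ⟶ A)
    (hm : A ◁ m ≫ m = (α_ A A A).inv ≫ m ▷ A ≫ m)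
    (hn : A ◁ n ≫ n = (α_ A A A).inv ≫ n ▷ A ≫ n)
    (hmn : A ◁ m ≫ n =
      (α_ A A A).inv ≫ (β_ A A).hom ▷ A ≫ (α_ A A A).hom ≫ A ◁ n ≫ m) :
    (tensorμ A A A A ≫ (m ⊗ₘ n)) ▷ A ≫ (α_ A A A).hom ≫ A ◁ n ≫ m =
      (α_ (A ⊗ A) (A ⊗ A) A).hom ≫ (A ⊗ A) ◁ ((α_ A A A).hom ≫ A ◁ n ≫ m) ≫
        (α_ A A A).hom ≫ A ◁ n ≫ m := by
  symm
  calc _ = 𝟙 _ ⊗≫ A ◁ A ◁ A ◁ n ⊗≫ A ◁ (A ◁ m ≫ n) ≫ m := by monoidal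
    _ = 𝟙 _ ⊗≫ A ◁ ((A ⊗ A) ◁ n ≫ (β_ A A).hom ▷ A) ⊗≫ A ◁ (A ◁ n ≫ m) ≫ m := by
      rw [hmn]; monoidal
    _ = 𝟙 _ ⊗≫ A ◁ ((β_ A A).hom ▷ (A ⊗ A)) ⊗≫ A ◁ A ◁ (A ◁ n ≫ n) ⊗≫ (A ◁ m ≫ m) := by
      rw [whisker_exchange]; monoidal
    _ = 𝟙 _ ⊗≫ A ◁ ((β_ A A).hom ▷ (A ⊗ A)) ⊗≫ A ◁ A ◁ (n ▷ A) ⊗≫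
          ((A ⊗ A) ◁ n ≫ m ▷ A) ≫ m := by
      rw [hm, hn]; monoidal
    _ = _ := by
      rw [whisker_exchange, tensorμ, tensorHom_def']; monoidal

/-- The left action `A ⊗ A^τ ⊗ A ⟶ A` of `A^e` on `A`: the composite of `A ⊗ τ`, `A ⊗ m`
and `m`. -/
def envelopingAction (A : Mon V) : (A.X ⊗ A.X) ⊗ A.X ⟶ A.X :=
  (α_ A.X A.X A.X).hom ≫ A.X ◁ ((β_ A.X A.X).hom ≫ MonObj.mul (X := A.X)) ≫
    MonObj.mul (X := A.X)

/-- The left module structure over the monad `A^e ⊗ -` on the functor `A ⊗ -`, given by the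
action of `A^e` on the left tensor factor of `A ⊗ X`. -/
def envelopingModuleFunctor (A : Mon V) :
    ModuleFunctor (leftMonad (envelopingAlgebra A)) (tensorLeft A.X) where
  act :=
    { app := fun X => (α_ (A.X ⊗ A.X) A.X X).inv ≫ envelopingAction A ▷ X
      naturality := fun X Y f => by
        change (A.X ⊗ A.X) ◁ (A.X ◁ f) ≫ (α_ (A.X ⊗ A.X) A.X Y).inv ≫ envelopingAction A ▷ Y =
          ((α_ (A.X ⊗ A.X) A.X X).inv ≫ envelopingAction A ▷ X) ≫ A.X ◁ f
        rw [Category.assoc, ← whisker_exchange]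
        simp }
  unit := fun X => leftAction_unit (A.X ⊗ A.X) A.X X (envelopingAction A)
    ((λ_ (𝟙_ V)).inv ≫ (MonObj.one (X := A.X) ⊗ₘ MonObj.one (X := A.X)))
    (envelopingAction_unit A.X _ _ _ (MonObj.one_mul A.X)
      (MonObj.one_mul (oppositeAlgebra A).X))
  assoc := fun X => leftAction_assoc (A.X ⊗ A.X) A.X X (envelopingAction A)
    (tensorμ A.X A.X A.X A.X ≫
      (MonObj.mul (X := A.X) ⊗ₘ ((β_ A.X A.X).hom ≫ MonObj.mul (X := A.X))))
    (envelopingAction_assoc A.X _ _ (MonObj.mul_assoc_flip A.X)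
      (MonObj.mul_assoc_flip (oppositeAlgebra A).X) (by
        rw [← Category.assoc (A.X ◁ _), mul_braiding_right]
        simp only [Category.assoc, MonObj.mul_assoc, Iso.inv_hom_id_assoc, whiskerLeft_comp]))

/-- For a left dual `A*` of `A`, with unit `db : I ⟶ A ⊗ A*`, the composite
`A ⊗ A ⟶ A ⊗ A ⊗ A ⊗ A* ⟶ A ⊗ A ⊗ A ⊗ A* ⟶ A ⊗ A ⊗ A* ⟶ A ⊗ A*` of
`A ⊗ A ⊗ db`, `A ⊗ τ ⊗ A*`, `m ⊗ A ⊗ A*` and `m ⊗ A*`. -/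
def chiZero (A : Mon V) (Astar : V) [ExactPairing A.X Astar] : A.X ⊗ A.X ⟶ A.X ⊗ Astar :=
  (ρ_ (A.X ⊗ A.X)).inv ≫ (A.X ⊗ A.X) ◁ η_ A.X Astar ≫
    (α_ A.X A.X (A.X ⊗ Astar)).hom ≫ A.X ◁ (α_ A.X A.X Astar).inv ≫
    A.X ◁ ((β_ A.X A.X).hom ▷ Astar) ≫
    A.X ◁ (α_ A.X A.X Astar).hom ≫ (α_ A.X A.X (A.X ⊗ Astar)).inv ≫
    MonObj.mul (X := A.X) ▷ (A.X ⊗ Astar) ≫ (α_ A.X A.X Astar).inv ≫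
    MonObj.mul (X := A.X) ▷ Astar

/-- For a right dual `A♯` of `A`, with unit `db' : I ⟶ A♯ ⊗ A`, the composite
`A ⊗ A ⟶ A♯ ⊗ A ⊗ A ⊗ A ⟶ A♯ ⊗ A ⊗ A ⟶ A♯ ⊗ A ⊗ A ⟶ A♯ ⊗ A` of
`db' ⊗ A ⊗ A`, `A♯ ⊗ m ⊗ A`, `A♯ ⊗ τ` and `A♯ ⊗ m`. -/
def chi (A : Mon V) (Asharp : V) [ExactPairing Asharp A.X] : A.X ⊗ A.X ⟶ Asharp ⊗ A.X :=
  (λ_ (A.X ⊗ A.X)).inv ≫ η_ Asharp A.X ▷ (A.X ⊗ A.X) ≫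
    (α_ Asharp A.X (A.X ⊗ A.X)).hom ≫ Asharp ◁ (α_ A.X A.X A.X).inv ≫
    Asharp ◁ (MonObj.mul (X := A.X) ▷ A.X) ≫ Asharp ◁ (β_ A.X A.X).hom ≫
    Asharp ◁ MonObj.mul (X := A.X)

end Algebras

end AzumayaCat

/-! Everything rests on comparing adjunctions along a functor `K`. If `R₂ K ≅ R₁`, with left
adjoints `L₁` and `L₂`, the mate `L₂ ⟶ K L₁` induces a morphism of monads and a square of comparison
functors. When the mate is invertible and `R₂` is monadic, `R₁` is monadic exactly when `K` is an
equivalence. The dual statement holds for comonads.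

(a) ⇔ (b): take `K` to be the lift of `A ⊗ -` to `A^e`-modules. The mate then has the Galois map as
its underlying morphism (`ModuleFunctor.isEquivalence_lift_iff`).

(b) ⇔ (c): the Galois map at `I` is `χ₀` for the candidate dual `L I`. The canonical map `L X ⟶ L I
⊗ X` becomes invertible after `A ⊗ -`, and a monadic functor reflects isomorphisms. So `L` is `L I ⊗
-` and `L I` is a left dual. Conversely, for a left dual the Galois map at `X` is `χ₀ ⊗ X`.
Multiplicativity of `χ₀` is automatic, since it is the transpose of an action on `A`.

(a) ⇔ (d): the free functor to `A^τ`-modules is the comparison functor followed by restriction from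
bimodules. If `N ↦ A ⊗ N` is right adjoint to restriction, then restriction is comonadic by Beck's
theorem, and the comonadic comparison applies. This adjointness amounts to `BDLaw.HasCofree`, and it
follows from (a). In the presence of a right dual it says that a mate `A ⊗ N ⟶ A♯ ⊗ N` is invertible
for every `N`. Free `N` suffice, and there the mate is `χ ⊗ X`. -/

namespace AzumayaCat

/-! ### Mates and comparison functors. -/

section Comparison

universe v₁ v₂ v₃ u₁ u₂ u₃

variable {C : Type u₁} [Category.{v₁} C] {D : Type u₂} [Category.{v₂} D]
  {E : Type u₃} [Category.{v₃} E]

/-- The functor between categories of coalgebras induced by a morphism of comonads. -/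
def coalgebraFunctor {M N : Comonad C} (t : M ⟶ N) : M.Coalgebra ⥤ N.Coalgebra where
  obj X :=
    { A := X.A
      a := X.a ≫ t.app X.A
      counit := by
        rw [Category.assoc, t.app_ε]
        exact X.counit
      coassoc := by
        have h := t.naturality X.a
        rw [Category.assoc, t.app_δ, X.coassoc_assoc, N.map_comp, Category.assoc,
          ← reassoc_of% h] }
  map {X Y} f :=
    { f := f.f
      h := by
        have h := t.naturality f.f
        exact (Category.assoc _ _ _).trans ((congrArg (X.a ≫ ·) h.symm).trans (f.h_assoc _)) }

instance {M N : Comonad C} (t : M ⟶ N) : (coalgebraFunctor t).Faithful where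
  map_injective {_ _} _ _ h := Comonad.Coalgebra.Hom.ext (congrArg Comonad.Coalgebra.Hom.f h :)

theorem coalgebraFunctor_isEquivalence {M N : Comonad C} (t : M ⟶ N)
    [∀ X, IsIso (t.app X)] : (coalgebraFunctor t).IsEquivalence where
  full :=
    { map_surjective := fun {X Y} f => by
        obtain ⟨f, h1⟩ := f
        change X.A ⟶ Y.A at f
        change (X.a ≫ t.app X.A) ≫ N.map f = f ≫ Y.a ≫ t.app Y.A at h1
        have h2 := t.naturality f
        refine ⟨{ f := f, h := ?_ }, rfl⟩
        rw [← cancel_mono (t.app Y.A), Category.assoc, Category.assoc, h2, ← h1,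
          Category.assoc] }
  essSurj :=
    { mem_essImage := fun X =>
        ⟨{ A := X.A
           a := X.a ≫ inv (t.app X.A)
           counit := by
            rw [← t.app_ε, Category.assoc, IsIso.inv_hom_id_assoc, X.counit]
           coassoc := by
            have h := t.naturality (X.a ≫ inv (t.app X.A))
            rw [← cancel_mono (t.app (M.obj X.A)), ← cancel_mono (N.map (t.app X.A))]
            simp only [Category.assoc]
            rw [reassoc_of% h]
            rw [← t.app_δ, ← N.map_comp, IsIso.inv_hom_id_assoc, Category.assoc,
              IsIso.inv_hom_id, Category.comp_id, IsIso.inv_hom_id_assoc, X.coassoc] },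
          ⟨Comonad.Coalgebra.isoMk (Iso.refl _) (by simp [coalgebraFunctor])⟩⟩ }

/-! ### Comparing two comonadic situations. -/

section Comonadic

variable {L₁ : C ⥤ D} {R₁ : D ⥤ C} {L₂ : E ⥤ D} {R₂ : D ⥤ E} {K : C ⥤ E}

theorem inv_app_naturality (i : K ⋙ L₂ ≅ L₁) {X Y : C} (f : X ⟶ Y) :
    L₁.map f ≫ i.inv.app Y = i.inv.app X ≫ L₂.map (K.map f) :=
  i.inv.naturality f

/-- The mate `K R₁ ⟶ R₂` of an isomorphism `L₂ K ≅ L₁`. -/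
def rightMate (adj₁ : L₁ ⊣ R₁) (adj₂ : L₂ ⊣ R₂) (i : K ⋙ L₂ ≅ L₁) (Y : D) :
    K.obj (R₁.obj Y) ⟶ R₂.obj Y :=
  adj₂.homEquiv _ _ (i.hom.app (R₁.obj Y) ≫ adj₁.counit.app Y)

theorem rightMate_counit (adj₁ : L₁ ⊣ R₁) (adj₂ : L₂ ⊣ R₂) (i : K ⋙ L₂ ≅ L₁) (Y : D) :
    L₂.map (rightMate adj₁ adj₂ i Y) ≫ adj₂.counit.app Y =
      i.hom.app (R₁.obj Y) ≫ adj₁.counit.app Y :=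
  (adj₂.homEquiv_counit (g := rightMate adj₁ adj₂ i Y)).symm.trans
    ((adj₂.homEquiv _ _).symm_apply_apply _)

theorem rightMate_naturality (adj₁ : L₁ ⊣ R₁) (adj₂ : L₂ ⊣ R₂) (i : K ⋙ L₂ ≅ L₁) {Y Z : D}
    (f : Y ⟶ Z) :
    K.map (R₁.map f) ≫ rightMate adj₁ adj₂ i Z = rightMate adj₁ adj₂ i Y ≫ R₂.map f := by
  have h := i.hom.naturality (R₁.map f)
  apply (adj₂.homEquiv _ _).symm.injective
  simp only [Adjunction.homEquiv_counit, Functor.map_comp, Category.assoc,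
    Adjunction.counit_naturality, rightMate_counit, Functor.comp_map] at h ⊢
  rw [reassoc_of% rightMate_counit adj₁ adj₂ i Y, reassoc_of% h, Adjunction.counit_naturality]

theorem unit_rightMate (adj₁ : L₁ ⊣ R₁) (adj₂ : L₂ ⊣ R₂) (i : K ⋙ L₂ ≅ L₁) (X : C) :
    K.map (adj₁.unit.app X) ≫ rightMate adj₁ adj₂ i (L₁.obj X) =
      adj₂.unit.app (K.obj X) ≫ R₂.map (i.hom.app X) := by
  have h := i.hom.naturality (adj₁.unit.app X)
  apply (adj₂.homEquiv _ _).symm.injective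
  simp only [Adjunction.homEquiv_counit, Functor.map_comp, Category.assoc,
    Adjunction.counit_naturality, rightMate_counit, Functor.comp_map] at h ⊢
  rw [reassoc_of% h]
  simp

/-- When `K` is an equivalence, `K R₁` and `R₂` represent the same functor `P ↦ Hom(L₂ P, Y)`, and
the mate is the resulting Yoneda isomorphism. -/
theorem isIso_rightMate (adj₁ : L₁ ⊣ R₁) (adj₂ : L₂ ⊣ R₂) (i : K ⋙ L₂ ≅ L₁)
    [K.IsEquivalence] (Y : D) : IsIso (rightMate adj₁ adj₂ i Y) := by
  apply isIso_of_yoneda_map_bijective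
  intro P
  let p := K.objObjPreimageIso P
  let e := (p.homCongr (Iso.refl (K.obj (R₁.obj Y)))).symm.trans
    ((Functor.FullyFaithful.ofFullyFaithful K).homEquiv.symm.trans
      ((adj₁.homEquiv _ Y).symm.trans
        (((i.app _).symm.homCongr (Iso.refl Y)).trans
          ((adj₂.homEquiv _ Y).trans (p.homCongr (Iso.refl _))))))
  convert e.bijective using 1
  funext x
  obtain ⟨x, rfl⟩ : ∃ y, x = p.inv ≫ K.map y :=
    ⟨K.preimage (p.hom ≫ x), by simp⟩
  apply (adj₂.homEquiv _ _).symm.injective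
  have h : L₂.map (K.map x) ≫ i.hom.app _ = i.hom.app _ ≫ L₁.map x := i.hom.naturality x
  simp [e, Iso.homCongr, rightMate, ← Adjunction.homEquiv_naturality_left, reassoc_of% h,
    Adjunction.homEquiv_counit]

theorem comonadHom_naturality (adj₁ : L₁ ⊣ R₁) (adj₂ : L₂ ⊣ R₂) (i : K ⋙ L₂ ≅ L₁) {Y Z : D}
    (f : Y ⟶ Z) : L₁.map (R₁.map f) ≫ i.inv.app (R₁.obj Z) ≫ L₂.map (rightMate adj₁ adj₂ i Z) =
      (i.inv.app (R₁.obj Y) ≫ L₂.map (rightMate adj₁ adj₂ i Y)) ≫ L₂.map (R₂.map f) := by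
  rw [reassoc_of% inv_app_naturality i (R₁.map f), Category.assoc, ← L₂.map_comp, ← L₂.map_comp,
      rightMate_naturality]

theorem comonadHom_δ (adj₁ : L₁ ⊣ R₁) (adj₂ : L₂ ⊣ R₂) (i : K ⋙ L₂ ≅ L₁) (Y : D) :
    (i.inv.app (R₁.obj Y) ≫ L₂.map (rightMate adj₁ adj₂ i Y)) ≫
        L₂.map (adj₂.unit.app (R₂.obj Y)) =
      L₁.map (adj₁.unit.app (R₁.obj Y)) ≫
        (i.inv.app _ ≫ L₂.map (rightMate adj₁ adj₂ i _)) ≫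
          L₂.map (R₂.map (i.inv.app (R₁.obj Y) ≫ L₂.map (rightMate adj₁ adj₂ i Y))) := by
  have h := inv_app_naturality i (Y := R₁.obj (L₁.obj (R₁.obj Y))) (adj₁.unit.app (R₁.obj Y))
  have h' := unit_rightMate adj₁ adj₂ i (R₁.obj Y)
  simp only [Category.assoc, Functor.comp_obj, Functor.id_obj] at h ⊢
  rw [reassoc_of% h, ← L₂.map_comp, ← L₂.map_comp, ← L₂.map_comp,
    reassoc_of% h', ← R₂.map_comp, Iso.hom_inv_id_app_assoc, Adjunction.unit_naturality]

/-- The morphism of comonads induced by the mate of an isomorphism `L₂ K ≅ L₁`. -/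
def comonadHomOfIso (adj₁ : L₁ ⊣ R₁) (adj₂ : L₂ ⊣ R₂) (i : K ⋙ L₂ ≅ L₁) :
    adj₁.toComonad ⟶ adj₂.toComonad where
  app Y := i.inv.app (R₁.obj Y) ≫ L₂.map (rightMate adj₁ adj₂ i Y)
  naturality Y Z f := comonadHom_naturality adj₁ adj₂ i f
  app_ε Y := by
    refine (Category.assoc _ _ _).trans ((congrArg (i.inv.app (R₁.obj Y) ≫ ·)
      (rightMate_counit adj₁ adj₂ i Y)).trans ?_)
    exact i.inv_hom_id_app_assoc _ _
  app_δ Y := comonadHom_δ adj₁ adj₂ i Y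

/-- An isomorphism `L₂ K ≅ L₁` is compatible with the comparison functors. -/
def comparisonCompIso (adj₁ : L₁ ⊣ R₁) (adj₂ : L₂ ⊣ R₂) (i : K ⋙ L₂ ≅ L₁) :
    K ⋙ Comonad.comparison adj₂ ≅
      Comonad.comparison adj₁ ⋙ coalgebraFunctor (comonadHomOfIso adj₁ adj₂ i) :=
  NatIso.ofComponents (fun X => Comonad.Coalgebra.isoMk (i.app X) (by
    have h := inv_app_naturality i (Y := R₁.obj (L₁.obj X)) (adj₁.unit.app X)
    have h' := unit_rightMate adj₁ adj₂ i X
    change L₂.map (adj₂.unit.app (K.obj X)) ≫ L₂.map (R₂.map (i.hom.app X)) =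
      i.hom.app X ≫ L₁.map (adj₁.unit.app X) ≫ i.inv.app (R₁.obj (L₁.obj X)) ≫
        L₂.map (rightMate adj₁ adj₂ i _)
    simp only [Functor.id_obj] at h
    rw [reassoc_of% h, ← L₂.map_comp, ← L₂.map_comp, h']
    exact (i.hom_inv_id_app_assoc _ _).symm))
    (fun f => Comonad.Coalgebra.Hom.ext (i.hom.naturality f))

/-- An invertible mate makes the two comonads isomorphic, so three of the four sides of the
comparison square reduce to two; the rest is two-out-of-three. -/
theorem isEquivalence_comparison_iff (adj₁ : L₁ ⊣ R₁) (adj₂ : L₂ ⊣ R₂) (i : K ⋙ L₂ ≅ L₁)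
    (h : ∀ Y, IsIso (rightMate adj₁ adj₂ i Y)) [(Comonad.comparison adj₂).IsEquivalence] :
    (Comonad.comparison adj₁).IsEquivalence ↔ K.IsEquivalence := by
  have : ∀ Y, IsIso ((comonadHomOfIso adj₁ adj₂ i).app Y) := fun Y =>
    inferInstanceAs (IsIso (i.inv.app (R₁.obj Y) ≫ L₂.map (rightMate adj₁ adj₂ i Y)))
  have := coalgebraFunctor_isEquivalence (comonadHomOfIso adj₁ adj₂ i)
  constructor
  · intro _
    have := Functor.isEquivalence_of_iso (comparisonCompIso adj₁ adj₂ i).symm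
    exact Functor.isEquivalence_of_comp_right K (Comonad.comparison adj₂)
  · intro _
    have := Functor.isEquivalence_of_iso (comparisonCompIso adj₁ adj₂ i)
    exact Functor.isEquivalence_of_comp_right _ (coalgebraFunctor (comonadHomOfIso adj₁ adj₂ i))

/-- The case where `K` is the identity: comonadicity does not depend on the chosen right adjoint. -/
theorem isComonadic_iff (adj : L₁ ⊣ R₁) :
    IsComonadic L₁ ↔ (Comonad.comparison adj).IsEquivalence := by
  constructor
  · rintro ⟨⟨R, adj', _⟩⟩
    exact (isEquivalence_comparison_iff adj adj' (Functor.leftUnitor L₁)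
      (isIso_rightMate adj adj' _)).2 inferInstance
  · intro h
    exact ⟨⟨R₁, adj, h⟩⟩

end Comonadic

/-! ### Comparing two monadic situations; Galois module functors. -/

section Monadic

variable {L₁ : C ⥤ D} {R₁ : D ⥤ C} {L₂ : C ⥤ E} {R₂ : E ⥤ C} {K : D ⥤ E}

theorem hom_app_naturality (i : K ⋙ R₂ ≅ R₁) {X Y : D} (f : X ⟶ Y) :
    R₂.map (K.map f) ≫ i.hom.app Y = i.hom.app X ≫ R₁.map f :=
  i.hom.naturality f

/-- The mate `L₂ ⟶ K L₁` of an isomorphism `R₂ K ≅ R₁`. -/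
def leftMate (adj₁ : L₁ ⊣ R₁) (adj₂ : L₂ ⊣ R₂) (i : K ⋙ R₂ ≅ R₁) (X : C) :
    L₂.obj X ⟶ K.obj (L₁.obj X) :=
  (adj₂.homEquiv X (K.obj (L₁.obj X))).symm (adj₁.unit.app X ≫ i.inv.app (L₁.obj X))

theorem unit_leftMate (adj₁ : L₁ ⊣ R₁) (adj₂ : L₂ ⊣ R₂) (i : K ⋙ R₂ ≅ R₁) (X : C) :
    adj₂.unit.app X ≫ R₂.map (leftMate adj₁ adj₂ i X) =
      adj₁.unit.app X ≫ i.inv.app (L₁.obj X) :=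
  (adj₂.homEquiv_unit (f := leftMate adj₁ adj₂ i X)).symm.trans
    ((adj₂.homEquiv _ _).apply_symm_apply _)

theorem leftMate_naturality (adj₁ : L₁ ⊣ R₁) (adj₂ : L₂ ⊣ R₂) (i : K ⋙ R₂ ≅ R₁) {X Y : C}
    (f : X ⟶ Y) :
    L₂.map f ≫ leftMate adj₁ adj₂ i Y = leftMate adj₁ adj₂ i X ≫ K.map (L₁.map f) := by
  have h : R₁.map (L₁.map f) ≫ i.inv.app _ = i.inv.app _ ≫ R₂.map (K.map (L₁.map f)) :=
    i.inv.naturality (L₁.map f)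
  apply (adj₂.homEquiv _ _).injective
  simp only [Adjunction.homEquiv_unit, Functor.map_comp]
  rw [reassoc_of% unit_leftMate adj₁ adj₂ i X, Adjunction.unit_naturality_assoc,
    unit_leftMate, ← h, Adjunction.unit_naturality_assoc]

theorem leftMate_counit (adj₁ : L₁ ⊣ R₁) (adj₂ : L₂ ⊣ R₂) (i : K ⋙ R₂ ≅ R₁) (Y : D) :
    leftMate adj₁ adj₂ i (R₁.obj Y) ≫ K.map (adj₁.counit.app Y) =
      L₂.map (i.inv.app Y) ≫ adj₂.counit.app (K.obj Y) := by
  have h : R₁.map (adj₁.counit.app Y) ≫ i.inv.app _ =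
    i.inv.app _ ≫ R₂.map (K.map (adj₁.counit.app Y)) := i.inv.naturality (adj₁.counit.app Y)
  apply (adj₂.homEquiv _ _).injective
  simp only [Adjunction.homEquiv_unit, Functor.map_comp]
  have h' := unit_leftMate adj₁ adj₂ i (R₁.obj Y)
  simp only [Functor.comp_obj, Functor.id_obj] at h h' ⊢
  rw [reassoc_of% h', ← h, Adjunction.right_triangle_components_assoc]
  simp

theorem isIso_leftMate (adj₁ : L₁ ⊣ R₁) (adj₂ : L₂ ⊣ R₂) (i : K ⋙ R₂ ≅ R₁)
    [K.IsEquivalence] (X : C) : IsIso (leftMate adj₁ adj₂ i X) := by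
  apply isIso_of_coyoneda_map_bijective
  intro P
  let p := K.objObjPreimageIso P
  let e := ((Iso.refl (K.obj (L₁.obj X))).homCongr p).symm.trans
    ((Functor.FullyFaithful.ofFullyFaithful K).homEquiv.symm.trans
      ((adj₁.homEquiv X _).trans
        (((Iso.refl X).homCongr (i.app _).symm).trans
          ((adj₂.homEquiv X _).symm.trans ((Iso.refl _).homCongr p)))))
  convert e.bijective using 1
  funext x
  obtain ⟨x, rfl⟩ : ∃ y, x = K.map y ≫ p.hom :=
    ⟨K.preimage (x ≫ p.inv), by simp⟩
  have h : R₁.map x ≫ i.inv.app _ = i.inv.app _ ≫ R₂.map (K.map x) := i.inv.naturality x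
  simp [e, Iso.homCongr, leftMate, ← Adjunction.homEquiv_naturality_right_symm, h,
    Adjunction.homEquiv_unit]

theorem monadHom_naturality (adj₁ : L₁ ⊣ R₁) (adj₂ : L₂ ⊣ R₂) (i : K ⋙ R₂ ≅ R₁) {X Y : C}
    (f : X ⟶ Y) :
    R₂.map (L₂.map f) ≫ R₂.map (leftMate adj₁ adj₂ i Y) ≫ i.hom.app (L₁.obj Y) =
      (R₂.map (leftMate adj₁ adj₂ i X) ≫ i.hom.app (L₁.obj X)) ≫ R₁.map (L₁.map f) := by
  rw [Category.assoc, ← hom_app_naturality, ← R₂.map_comp_assoc, leftMate_naturality,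
    R₂.map_comp_assoc]

theorem monadHom_μ (adj₁ : L₁ ⊣ R₁) (adj₂ : L₂ ⊣ R₂) (i : K ⋙ R₂ ≅ R₁) (X : C) :
    R₂.map (adj₂.counit.app (L₂.obj X)) ≫ R₂.map (leftMate adj₁ adj₂ i X) ≫
        i.hom.app (L₁.obj X) =
      (R₂.map (L₂.map (R₂.map (leftMate adj₁ adj₂ i X) ≫ i.hom.app (L₁.obj X))) ≫
        R₂.map (leftMate adj₁ adj₂ i (R₁.obj (L₁.obj X))) ≫ i.hom.app _) ≫
          R₁.map (adj₁.counit.app (L₁.obj X)) := by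
  have h := hom_app_naturality i (Y := L₁.obj X) (adj₁.counit.app (L₁.obj X))
  have h' := leftMate_counit adj₁ adj₂ i (L₁.obj X)
  simp only [Category.assoc, Functor.comp_obj, Functor.id_obj] at h ⊢
  rw [← h, ← R₂.map_comp_assoc, ← R₂.map_comp_assoc, ← R₂.map_comp_assoc, Category.assoc, h',
    ← L₂.map_comp_assoc, Category.assoc, Iso.hom_inv_id_app]
  congr 2
  simp

/-- The morphism of monads induced by the mate of an isomorphism `R₂ K ≅ R₁`. -/
def monadHomOfIso (adj₁ : L₁ ⊣ R₁) (adj₂ : L₂ ⊣ R₂) (i : K ⋙ R₂ ≅ R₁) :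
    adj₂.toMonad ⟶ adj₁.toMonad where
  app X := R₂.map (leftMate adj₁ adj₂ i X) ≫ i.hom.app (L₁.obj X)
  naturality X Y f := monadHom_naturality adj₁ adj₂ i f
  app_η X := by
    refine (Category.assoc _ _ _).symm.trans ((congrArg (· ≫ i.hom.app (L₁.obj X))
      (unit_leftMate adj₁ adj₂ i X)).trans ?_)
    exact (Category.assoc _ _ _).trans ((congrArg (adj₁.unit.app X ≫ ·)
      (i.inv_hom_id_app (L₁.obj X))).trans (Category.comp_id _))
  app_μ X := monadHom_μ adj₁ adj₂ i X

/-- An isomorphism `R₂ K ≅ R₁` is compatible with the comparison functors. -/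
def monadComparisonCompIso (adj₁ : L₁ ⊣ R₁) (adj₂ : L₂ ⊣ R₂) (i : K ⋙ R₂ ≅ R₁) :
    K ⋙ Monad.comparison adj₂ ≅
      Monad.comparison adj₁ ⋙ Monad.algebraFunctorOfMonadHom (monadHomOfIso adj₁ adj₂ i) :=
  NatIso.ofComponents (fun Y => Monad.Algebra.isoMk (i.app Y) (by
    have h := hom_app_naturality i (Y := Y) (adj₁.counit.app Y)
    have h' := leftMate_counit adj₁ adj₂ i Y
    change R₂.map (L₂.map (i.hom.app Y)) ≫ (R₂.map (leftMate adj₁ adj₂ i (R₁.obj Y)) ≫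
      i.hom.app (L₁.obj (R₁.obj Y))) ≫ R₁.map (adj₁.counit.app Y) =
        R₂.map (adj₂.counit.app (K.obj Y)) ≫ i.hom.app Y
    simp only [Category.assoc, Functor.id_obj, Functor.comp_obj] at h h' ⊢
    rw [← h, ← R₂.map_comp_assoc, ← R₂.map_comp_assoc, Category.assoc, h',
      ← L₂.map_comp_assoc, Iso.hom_inv_id_app]
    congr 2
    simp))
    (fun f => Monad.Algebra.Hom.ext (i.hom.naturality f))

theorem isEquivalence_monadComparison_iff (adj₁ : L₁ ⊣ R₁) (adj₂ : L₂ ⊣ R₂) (i : K ⋙ R₂ ≅ R₁)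
    (h : ∀ X, IsIso (leftMate adj₁ adj₂ i X)) [(Monad.comparison adj₂).IsEquivalence] :
    (Monad.comparison adj₁).IsEquivalence ↔ K.IsEquivalence := by
  have : IsIso ((monadToFunctor C).map (monadHomOfIso adj₁ adj₂ i)) := by
    rw [NatTrans.isIso_iff_isIso_app]
    intro X
    have := h X
    exact inferInstanceAs (IsIso (R₂.map (leftMate adj₁ adj₂ i X) ≫ i.hom.app (L₁.obj X)))
  have : IsIso (monadHomOfIso adj₁ adj₂ i) := isIso_of_reflects_iso _ (monadToFunctor C)
  have : (Monad.algebraFunctorOfMonadHom (monadHomOfIso adj₁ adj₂ i)).IsEquivalence :=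
    (Monad.algebraEquivOfIsoMonads (asIso (monadHomOfIso adj₁ adj₂ i))).isEquivalence_inverse
  constructor
  · intro _
    have := Functor.isEquivalence_of_iso (monadComparisonCompIso adj₁ adj₂ i).symm
    exact Functor.isEquivalence_of_comp_right K (Monad.comparison adj₂)
  · intro _
    have := Functor.isEquivalence_of_iso (monadComparisonCompIso adj₁ adj₂ i)
    exact Functor.isEquivalence_of_comp_right _
      (Monad.algebraFunctorOfMonadHom (monadHomOfIso adj₁ adj₂ i))

theorem isMonadic_iff (adj : L₁ ⊣ R₁) :
    IsMonadic R₁ ↔ (Monad.comparison adj).IsEquivalence := by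
  constructor
  · rintro ⟨⟨R, adj', _⟩⟩
    exact (isEquivalence_monadComparison_iff adj adj' (Functor.leftUnitor R₁)
      (isIso_leftMate adj adj' _)).2 inferInstance
  · intro h
    exact ⟨⟨L₁, adj, h⟩⟩

/-- Since the forgetful functor preserves and reflects isomorphisms, this turns the Galois condition
into invertibility of a mate. -/
theorem toAdjunctionMonad_app {T : Monad C} (M : ModuleFunctor T R₁) (adj : L₁ ⊣ R₁) (X : C) :
    (M.toAdjunctionMonad adj).app X =
      T.forget.map (leftMate adj T.adj (Iso.refl (M.lift ⋙ T.forget)) X) := by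
  have h {Y Z : C} (f : X ⟶ Y) (g : T.obj Y ⟶ Z) :
      T.map f ≫ g = T.map (f ≫ 𝟙 Y) ≫ T.map (𝟙 Y) ≫ g := by simp
  exact h (adj.unit.app X) (M.act.app (L₁.obj X))

/-- The functor into the Eilenberg-Moore category of `T` defined by a `T`-module functor `R` is an
equivalence if and only if `R` is monadic and Galois. -/
theorem ModuleFunctor.isEquivalence_lift_iff {T : Monad C} (M : ModuleFunctor T R₁) :
    M.lift.IsEquivalence ↔ IsMonadic R₁ ∧ M.IsGalois := by
  have : (Monad.comparison T.adj).IsEquivalence := { }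
  constructor
  · intro _
    -- No left adjoint of `R₁` is given here; the free functor followed by the quasi-inverse of the
    -- lift provides one.
    let adj : T.free ⋙ M.lift.inv ⊣ R₁ :=
      T.adj.comp M.lift.asEquivalence.symm.toAdjunction
    have h := isIso_leftMate adj T.adj (Iso.refl (M.lift ⋙ T.forget))
    refine ⟨(isMonadic_iff adj).2 ((isEquivalence_monadComparison_iff adj T.adj
      (Iso.refl (M.lift ⋙ T.forget)) h).2 inferInstance), _, adj, ?_⟩
    rw [NatTrans.isIso_iff_isIso_app]
    intro X
    rw [toAdjunctionMonad_app]
    have := h X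
    exact Functor.map_isIso _ _
  · rintro ⟨h₁, L, adj, h₂⟩
    refine (isEquivalence_monadComparison_iff adj T.adj (Iso.refl (M.lift ⋙ T.forget))
      fun X => ?_).1 ((isMonadic_iff adj).1 h₁)
    have h := (NatTrans.isIso_iff_isIso_app _).1 h₂ X
    rw [toAdjunctionMonad_app] at h
    exact @isIso_of_reflects_iso _ _ _ _ _ _ _ T.forget h _

end Monadic

end Comparison

/-! ### Right adjoints of the form `K R₁`. -/

section Transpose

universe v₁ v₂ v₃ u₁ u₂ u₃

variable {C : Type u₁} [Category.{v₁} C] {D : Type u₂} [Category.{v₂} D]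
  {E : Type u₃} [Category.{v₃} E]
  {L₁ : C ⥤ D} {R₁ : D ⥤ C} {L₂ : E ⥤ D} {K : C ⥤ E}

/-- For an adjunction `L₁ ⊣ R₁` and an isomorphism `L₂ K ≅ L₁`, the map
`Hom(P, K R₁ Y) ⟶ Hom(L₂ P, Y)`. It is bijective if and only if `K R₁` is right adjoint to `L₂`
with the evident counit. -/
def transpose (adj : L₁ ⊣ R₁) (i : K ⋙ L₂ ≅ L₁) (P : E) (Y : D) (f : P ⟶ K.obj (R₁.obj Y)) :
    L₂.obj P ⟶ Y :=
  L₂.map f ≫ i.hom.app (R₁.obj Y) ≫ adj.counit.app Y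

/-- A quasi-inverse of `K` yields some adjunction `L₂ ⊣ K R₁`. Its hom-bijection differs from
`transpose` only by composition with a mate, which is invertible. -/
theorem transpose_bijective_of_isEquivalence (adj : L₁ ⊣ R₁) (i : K ⋙ L₂ ≅ L₁)
    [K.IsEquivalence] (P : E) (Y : D) : Function.Bijective (transpose adj i P Y) := by
  let adj₂ : L₂ ⊣ R₁ ⋙ K := (K.asEquivalence.symm.toAdjunction.comp adj).ofNatIsoLeft
    (Functor.isoWhiskerLeft K.inv i.symm ≪≫ (Functor.associator _ _ _).symm ≪≫
      Functor.isoWhiskerRight K.asEquivalence.counitIso L₂ ≪≫ L₂.leftUnitor)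
  have := isIso_rightMate adj adj₂ i Y
  have h : transpose adj i P Y = fun f =>
      (adj₂.homEquiv P Y).symm ((Iso.refl P).homCongr (asIso (rightMate adj adj₂ i Y)) f) := by
    funext f
    rw [Iso.homCongr_apply, Iso.refl_inv, Category.id_comp, asIso_hom,
      Adjunction.homEquiv_counit, L₂.map_comp, Category.assoc, rightMate_counit]
    rfl
  rw [h]
  exact (adj₂.homEquiv P Y).symm.bijective.comp
    ((Iso.refl P).homCongr (asIso (rightMate adj adj₂ i Y))).bijective

/-- Bijectivity of the transposes is what makes `K R₁` right adjoint to `L₂`, and for this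
adjunction the mate is the identity. -/
theorem isComonadic_iff_isEquivalence (adj : L₁ ⊣ R₁) (i : K ⋙ L₂ ≅ L₁)
    (hb : ∀ P Y, Function.Bijective (transpose adj i P Y))
    (h : ∀ {R : D ⥤ E}, (L₂ ⊣ R) → IsComonadic L₂) : IsComonadic L₁ ↔ K.IsEquivalence := by
  let adj₂ : L₂ ⊣ R₁ ⋙ K := Adjunction.mkOfHomEquiv
    { homEquiv := fun P Y => (Equiv.ofBijective _ (hb P Y)).symm
      homEquiv_naturality_left_symm := fun f g => by
        change transpose _ _ _ _ _ = L₂.map f ≫ transpose _ _ _ _ _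
        simp [transpose]
      homEquiv_naturality_right := fun {P Y Z} f g => by
        rw [Equiv.symm_apply_eq]
        obtain ⟨f, rfl⟩ := (hb P Y).2 f
        have h : (Equiv.ofBijective _ (hb P Y)).symm (transpose adj i P Y f) = f :=
          (Equiv.ofBijective _ (hb P Y)).symm_apply_apply f
        rw [h]
        have h' := hom_app_naturality i (R₁.map g)
        change _ = L₂.map (f ≫ K.map (R₁.map g)) ≫ _
        simp only [transpose, Functor.map_comp, Category.assoc]
        rw [reassoc_of% h']
        simp }
  have := (isComonadic_iff adj₂).1 (h adj₂)
  rw [isComonadic_iff adj]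
  refine isEquivalence_comparison_iff adj adj₂ i fun Y => ?_
  have h : rightMate adj adj₂ i Y = 𝟙 _ := by
    have hc : adj₂.counit.app Y = transpose adj i _ Y (𝟙 _) := by simp [adj₂]
    apply (adj₂.homEquiv _ _).symm.injective
    rw [Adjunction.homEquiv_counit, Adjunction.homEquiv_counit, rightMate_counit, hc]
    simp [transpose]
  rw [h]
  infer_instance

end Transpose

/-! ### Comonadicity of restriction functors. -/

section Beck

variable {C : Type u} [Category.{v} C]

/-- Given the right adjoint, the other hypotheses of Beck's theorem are free: a cosplit pair has an
absolute equalizer in `C`, `T.forget` creates it, and `S.forget` reflects it. Both forgetful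
functors are linked by `G ⋙ S.forget = T.forget`. -/
theorem isComonadic_algebraFunctor {T S : Monad C} (t : S ⟶ T) {R : S.Algebra ⥤ T.Algebra}
    (adj : Monad.algebraFunctorOfMonadHom t ⊣ R) :
    IsComonadic (Monad.algebraFunctorOfMonadHom t) := by
  let G := Monad.algebraFunctorOfMonadHom t
  have : (G ⋙ S.forget).ReflectsIsomorphisms := inferInstanceAs T.forget.ReflectsIsomorphisms
  have := reflectsIsomorphisms_of_comp G S.forget
  have hl {P Q : T.Algebra} (f g : P ⟶ Q) [G.IsCosplitPair f g] :
      Limits.HasLimit (Limits.parallelPair f g ⋙ T.forget) := by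
    have : Limits.HasEqualizer (T.forget.map f) (T.forget.map g) :=
      Limits.hasEqualizer_of_hasSplitEqualizer (S.forget.map (G.map f)) (S.forget.map (G.map g))
    exact (Limits.hasLimit_iff_of_iso (Limits.diagramIsoParallelPair _)).2 this
  have : Comonad.HasEqualizerOfIsCosplitPair G :=
    ⟨fun f g _ => have := hl f g; hasLimit_of_created (Limits.parallelPair f g) T.forget⟩
  have : Comonad.PreservesLimitOfIsCosplitPair G := ⟨fun f g _ => by
    have := hl f g
    have : Limits.PreservesLimit (Limits.parallelPair f g) (G ⋙ S.forget) :=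
      inferInstanceAs (Limits.PreservesLimit (Limits.parallelPair f g) T.forget)
    exact Limits.preservesLimit_of_reflects_of_preserves G S.forget⟩
  exact ⟨Comonad.comonadicOfHasPreservesFSplitEqualizersOfReflectsIsomorphisms adj⟩

end Beck

/-! ### Modules over `F F^λ` as bimodules. -/

section EnvelopingModules

variable {C : Type u} [Category.{v} C] {F : Monad C}

theorem BDLaw.nat (l : BDLaw F) {X Y : C} (f : X ⟶ Y) :
    F.map (F.map f) ≫ l.hom.app Y = l.hom.app X ≫ F.map (F.map f) :=
  l.hom.naturality f

theorem BDLaw.unit_left_mul (l : BDLaw F) (X : C) :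
    F.η.app (F.obj X) ≫ l.hom.app X ≫ F.μ.app X = 𝟙 _ :=
  l.opposite.left_unit X

theorem BDLaw.unit_right_mul (l : BDLaw F) (X : C) :
    F.map (F.η.app X) ≫ l.hom.app X ≫ F.μ.app X = 𝟙 _ :=
  l.opposite.right_unit X

theorem BDLaw.mul_comm (l : BDLaw F) (X : C) :
    F.map (F.μ.app X) ≫ l.hom.app X ≫ F.μ.app X =
      l.hom.app (F.obj X) ≫ F.map (l.hom.app X) ≫ F.map (F.μ.app X) ≫ F.μ.app X := by
  have h := l.mul_right X
  rw [reassoc_of% h, F.assoc]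

theorem map_unit_naturality {X Y : C} (f : X ⟶ Y) :
    F.map f ≫ F.map (F.η.app Y) = F.map (F.η.app X) ≫ F.map (F.map f) := by
  rw [← F.map_comp, ← F.map_comp]
  exact congrArg F.map (F.η.naturality f)

section Action

variable (l : BDLaw F) {P : C} {a : F.obj (F.obj P) ⟶ P}

/-- Here `ha` is associativity of a module structure `a` over `F F^λ`. Inserting the inner unit
gives the left action `F.map (F.η.app P) ≫ a` of `F`; inserting the outer unit gives the right
action `F.η.app (F.obj P) ≫ a` of `F^λ`. This lemma and the next two insert units into `ha`. -/
theorem leftAct_assoc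
    (ha : (F.map (l.hom.app (F.obj P)) ≫ F.map (F.map (l.hom.app P ≫ F.μ.app P)) ≫
      F.μ.app (F.obj P)) ≫ a = F.map (F.map a) ≫ a) :
    F.μ.app P ≫ F.map (F.η.app P) ≫ a =
      F.map (F.map (F.η.app P) ≫ a) ≫ F.map (F.η.app P) ≫ a := by
  have h1 := map_unit_naturality (F := F) a
  have h2 : F.map (F.map (F.η.app P)) ≫ F.μ.app (F.obj P) = F.μ.app P ≫ F.map (F.η.app P) :=
    F.μ.naturality (F.η.app P)
  have h3 := l.unit_left (F.obj P)
  have h4 := l.unit_left_mul P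
  rw [F.map_comp, Category.assoc, reassoc_of% h1, ← ha]
  simp only [Category.assoc]
  rw [← F.map_comp_assoc (F.η.app (F.obj (F.obj P))), h3,
    ← F.map_comp_assoc (F.map (F.η.app (F.obj P))), ← F.map_comp, h4]
  simp only [Functor.id_obj, F.map_id, Category.id_comp]
  rw [reassoc_of% h2]

theorem leftAct_rightAct
    (ha : (F.map (l.hom.app (F.obj P)) ≫ F.map (F.map (l.hom.app P ≫ F.μ.app P)) ≫
      F.μ.app (F.obj P)) ≫ a = F.map (F.map a) ≫ a) :
    F.map (F.η.app (F.obj P) ≫ a) ≫ F.map (F.η.app P) ≫ a = a := by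
  have h1 := map_unit_naturality (F := F) a
  have h3 := l.unit_left (F.obj P)
  have h4 := l.unit_left_mul P
  rw [F.map_comp, Category.assoc, reassoc_of% h1, ← ha]
  simp only [Category.assoc]
  rw [← F.map_comp_assoc (F.η.app (F.obj (F.obj P))), h3,
    ← F.map_comp_assoc (F.map (F.η.app (F.obj P))), ← F.map_comp, h4]
  simp only [Functor.id_obj, F.map_id, Category.id_comp]
  rw [F.right_unit_assoc]

theorem hom_leftAct_rightAct
    (ha : (F.map (l.hom.app (F.obj P)) ≫ F.map (F.map (l.hom.app P ≫ F.μ.app P)) ≫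
      F.μ.app (F.obj P)) ≫ a = F.map (F.map a) ≫ a) :
    l.hom.app P ≫ a = F.map (F.map (F.η.app P) ≫ a) ≫ F.η.app (F.obj P) ≫ a := by
  have h1 : F.map a ≫ F.η.app (F.obj P) = F.η.app _ ≫ F.map (F.map a) := F.η.naturality (F.map a)
  have h2 : F.map (F.map (F.η.app P)) ≫ F.η.app (F.obj (F.obj (F.obj P))) =
    F.η.app (F.obj (F.obj P)) ≫ F.map (F.map (F.map (F.η.app P))) :=
      F.η.naturality (F.map (F.map (F.η.app P)))
  have h3 := congrArg F.map (l.nat (F.η.app P))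
  have h4 : l.hom.app P ≫ F.η.app (F.obj (F.obj P)) = F.η.app _ ≫ F.map (l.hom.app P) :=
    F.η.naturality (l.hom.app P)
  have h5 := F.left_unit (F.obj P)
  have h6 := congrArg (fun f => F.map (F.map f)) (l.unit_right_mul P)
  simp only [F.map_comp, F.map_id] at h3 h6
  rw [F.map_comp, Category.assoc, reassoc_of% h1, ← ha]
  simp only [F.map_comp, Category.assoc, Functor.id_obj] at h6 ⊢
  rw [reassoc_of% h2, reassoc_of% h3, reassoc_of% h6, ← reassoc_of% h4, F.left_unit_assoc]

end Action

/-- The key extension property: a morphism `f : P ⟶ N` that is linear on the right extends to a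
morphism `P ⟶ F N` that is linear on both sides. -/
theorem exists_bilinear (l : BDLaw F) [∀ X, Epi (l.hom.app X)] {P N : C} {p q : F.obj P ⟶ P}
    {h : F.obj N ⟶ N} (hp : F.μ.app P ≫ p = F.map p ≫ p) (hp' : F.η.app P ≫ p = 𝟙 P)
    (hpq : l.hom.app P ≫ F.map q ≫ p = F.map p ≫ q)
    (hh : (l.hom.app N ≫ F.μ.app N) ≫ h = F.map h ≫ h)
    (hb : ∀ X, Function.Bijective fun f : X ⟶ F.obj N => F.map f ≫ F.μ.app N ≫ h)
    (f : P ⟶ N) (hf : F.map f ≫ h = q ≫ f) :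
    ∃ g : P ⟶ F.obj N, F.map g ≫ F.μ.app N = p ≫ g ∧
      F.map g ≫ l.hom.app N ≫ F.μ.app N = q ≫ g ∧ g ≫ h = f := by
  -- A left linear `g` with `g ≫ h = f` must extend to `p ≫ f`, which forces this choice. Both
  -- linearity conditions then follow from injectivity in `hb`.
  obtain ⟨g, hg⟩ := (hb P).2 (p ≫ f)
  dsimp only at hg
  have hμ := F.μ.naturality g
  simp only [Functor.comp_map] at hμ
  refine ⟨g, ?_, ?_, ?_⟩
  · apply (hb _).1
    simp only [F.map_comp, Category.assoc, hg]
    rw [reassoc_of% F.assoc N, reassoc_of% hμ, hg, reassoc_of% hp]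
  · apply (hb _).1
    simp only [F.map_comp, Category.assoc, hg]
    have h1 := l.nat g
    have h2 := l.mul_comm N
    -- The exchange law `hpq` of the two actions only applies after precomposing with `λ`, hence the
    -- need for it to be epi.
    rw [← cancel_epi (l.hom.app P), ← reassoc_of% h1, ← reassoc_of% h2, reassoc_of% hpq, ← hf,
      ← F.map_comp_assoc p, ← hg]
    simp only [Category.assoc] at hh
    simp [hh]
  · have hη := F.η.naturality g
    simp only [Functor.id_map] at hη
    rw [← Category.id_comp f, ← hp', Category.assoc, ← hg, ← reassoc_of% hη, F.left_unit_assoc]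

end EnvelopingModules

/-! ### Cofree bimodules and the comonadic criterion. -/

section EnvelopingModules

variable {C : Type u} [Category.{v} C] {F : Monad C}

theorem BDLaw.opposite_mul_unit (l : BDLaw F) (X : C) :
    (l.hom.app X ≫ F.μ.app X) ≫ F.η.app (F.obj X) =
      (F.map (F.η.app (F.obj X)) ≫ F.η.app (F.obj (F.obj (F.obj X)))) ≫
        F.map (l.hom.app (F.obj X)) ≫ F.map (F.map (l.hom.app X ≫ F.μ.app X)) ≫
          F.μ.app (F.obj X) := by
  have h1 : l.hom.app (F.obj X) ≫ F.η.app (F.obj (F.obj (F.obj X))) =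
    F.η.app (F.obj (F.obj (F.obj X))) ≫ F.map (l.hom.app (F.obj X)) :=
      F.η.naturality (l.hom.app (F.obj X))
  have h2 : F.map (l.hom.app X ≫ F.μ.app X) ≫ F.η.app (F.obj (F.obj X)) =
    F.η.app (F.obj (F.obj (F.obj X))) ≫ F.map (F.map (l.hom.app X ≫ F.μ.app X)) :=
      F.η.naturality (F.map (l.hom.app X ≫ F.μ.app X))
  have h3 : (l.hom.app X ≫ F.μ.app X) ≫ F.η.app (F.obj X) =
    F.η.app (F.obj (F.obj X)) ≫ F.map (l.hom.app X ≫ F.μ.app X) :=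
      F.η.naturality (l.hom.app X ≫ F.μ.app X)
  have h4 := l.unit_right (F.obj X)
  have h5 := F.left_unit (F.obj X)
  rw [h3, Category.assoc, ← reassoc_of% h1, reassoc_of% h4, ← reassoc_of% h2, h5]
  exact congrArg (F.η.app (F.obj (F.obj X)) ≫ ·) (Category.comp_id _).symm

/-- The inclusion of the opposite monad into the enveloping monad. -/
def BDLaw.oppositeInclusion (l : BDLaw F) : l.opposite ⟶ l.enveloping where
  app X := F.η.app (F.obj X)
  naturality _ _ f := F.η.naturality (F.map f)
  app_η _ := rfl
  app_μ X := l.opposite_mul_unit X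

/-- The functor `C_{F F^λ} ⥤ C_{F^λ}`. -/
def BDLaw.restrict (l : BDLaw F) : l.enveloping.Algebra ⥤ l.opposite.Algebra :=
  Monad.algebraFunctorOfMonadHom l.oppositeInclusion

/-- The comparison functor lifts the free functor of the opposite monad. -/
def BDLaw.comparisonRestrict (l : BDLaw F) : l.comparison ⋙ l.restrict ≅ l.opposite.free :=
  NatIso.ofComponents (fun X => Monad.Algebra.isoMk (Iso.refl (F.obj X)) (by
    have h : F.map (𝟙 (F.obj X)) ≫ l.hom.app X ≫ F.μ.app X =
        (F.η.app _ ≫ F.map (l.hom.app X) ≫ F.map (F.μ.app X) ≫ F.μ.app X) ≫ 𝟙 (F.obj X) := by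
      have h1 := F.η.naturality (l.hom.app X ≫ F.μ.app X)
      simp only [Functor.id_map, Functor.map_comp, Category.assoc] at h1
      simp [← reassoc_of% h1]
    exact h))
    (fun f => by
      ext
      have h : F.map f ≫ 𝟙 _ = 𝟙 _ ≫ F.map f := by simp
      exact h)

/-- The candidate counit of restriction is thus the action `F N ⟶ N` itself. -/
theorem BDLaw.transpose_f (l : BDLaw F) {P : l.enveloping.Algebra} {N : l.opposite.Algebra}
    (f : P ⟶ l.comparison.obj N.A) :
    (transpose l.opposite.adj l.comparisonRestrict P N f).f = f.f ≫ N.a := by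
  have h {X Y : C} (g : X ⟶ F.obj N.A) (h : F.obj N.A ⟶ Y) :
    g ≫ 𝟙 (F.obj N.A) ≫ F.map (𝟙 N.A) ≫ h = g ≫ h := by simp
  exact h f.f N.a

/-- For every right module `N`, the free bimodule `F N` is also cofree: every `F X ⟶ N` is induced
by a unique morphism `X ⟶ F N`. -/
def BDLaw.HasCofree (l : BDLaw F) : Prop :=
  ∀ (N : l.opposite.Algebra) (X : C), Function.Bijective
    fun f : X ⟶ F.obj N.A => F.map f ≫ F.μ.app N.A ≫ (N.a : F.obj N.A ⟶ N.A)

/-- Inserting the unit of `F^λ` extracts left linearity from bilinearity. -/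
theorem BDLaw.map_comp_mul_of_hom (l : BDLaw F) {P : C} {a : F.obj (F.obj P) ⟶ P} {Y : C}
    (f : P ⟶ F.obj Y)
    (hf : F.map (F.map f) ≫ F.map (l.hom.app Y) ≫ F.map (F.μ.app Y) ≫ F.μ.app Y = a ≫ f) :
    F.map f ≫ F.μ.app Y = (F.map (F.η.app P) ≫ a) ≫ f := by
  have h := congrArg F.map (l.unit_left_mul Y)
  simp only [F.map_comp, F.map_id] at h
  rw [Category.assoc, ← hf, ← reassoc_of% map_unit_naturality f, reassoc_of% h]

/-- By left linearity the map `F P ⟶ N` induced by a bilinear `f` depends only on `f ≫ N.a`, which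
gives injectivity; surjectivity is `exists_bilinear`. -/
theorem BDLaw.HasCofree.transpose_bijective {l : BDLaw F} (hl : l.HasCofree)
    [∀ X, Epi (l.hom.app X)] (P : l.enveloping.Algebra) (N : l.opposite.Algebra) :
    Function.Bijective (transpose l.opposite.adj l.comparisonRestrict P N) := by
  obtain ⟨P, a, hu, ha⟩ := P
  change F.obj (F.obj P) ⟶ P at a
  constructor
  · intro f g hfg
    have h : f.f ≫ N.a = g.f ≫ N.a :=
      (l.transpose_f f).symm.trans ((congrArg Monad.Algebra.Hom.f hfg).trans (l.transpose_f g))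
    obtain ⟨f, hf⟩ := f
    obtain ⟨g, hg⟩ := g
    ext
    change P ⟶ F.obj N.A at f
    change P ⟶ F.obj N.A at g
    have hf' := l.map_comp_mul_of_hom f hf
    have hg' := l.map_comp_mul_of_hom g hg
    apply (hl N P).1
    obtain ⟨N, n, _, _⟩ := N
    change F.obj N ⟶ N at n
    change f ≫ n = g ≫ n at h
    change F.map f ≫ F.μ.app N ≫ n = F.map g ≫ F.μ.app N ≫ n
    rw [reassoc_of% hf', reassoc_of% hg', h]
  · rintro ⟨k, hk⟩
    obtain ⟨N, n, hn, hn'⟩ := N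
    change F.obj N ⟶ N at n
    change P ⟶ N at k
    change F.map k ≫ n = (F.η.app (F.obj P) ≫ a) ≫ k at hk
    have hu' : F.η.app P ≫ F.map (F.η.app P) ≫ a = 𝟙 P := by
      rw [← Category.assoc]
      refine Eq.trans ?_ hu
      exact congrArg (· ≫ a) (F.η.naturality (F.η.app P)).symm
    obtain ⟨g, hg, hg', rfl⟩ := exists_bilinear l (leftAct_assoc l ha) hu'
      ((congrArg (l.hom.app P ≫ ·) (leftAct_rightAct l ha)).trans (hom_leftAct_rightAct l ha))
      hn' (hl ⟨N, n, hn, hn'⟩) k hk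
    refine ⟨⟨g, ?_⟩, Monad.Algebra.Hom.ext (l.transpose_f _)⟩
    have h : F.map (F.map g) ≫ F.map (l.hom.app N) ≫ F.map (F.μ.app N) ≫ F.μ.app N = a ≫ g := by
      rw [← F.map_comp_assoc, ← F.map_comp_assoc, Category.assoc, hg', F.map_comp_assoc, hg,
        ← Category.assoc, leftAct_rightAct l ha]
    exact h

/-- After precomposition with `λ`, each side becomes an expression in `F.map f ≫ F.μ.app N ≫ n`
alone. This is injectivity tested on the free bimodule on `X`. -/
theorem BDLaw.map_mul_comp (l : BDLaw F) [∀ X, Epi (l.hom.app X)] {X N : C}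
    {n : F.obj N ⟶ N} (hn : (l.hom.app N ≫ F.μ.app N) ≫ n = F.map n ≫ n)
    {f g : X ⟶ F.obj N} (h : F.map f ≫ F.μ.app N ≫ n = F.map g ≫ F.μ.app N ≫ n) :
    (F.map (F.map f) ≫ F.map (l.hom.app N) ≫ F.map (F.μ.app N) ≫ F.μ.app N) ≫ n =
      (F.map (F.map g) ≫ F.map (l.hom.app N) ≫ F.map (F.μ.app N) ≫ F.μ.app N) ≫ n := by
  have h1 (f : X ⟶ F.obj N) : l.hom.app X ≫ (F.map (F.map f) ≫ F.map (l.hom.app N) ≫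
      F.map (F.μ.app N) ≫ F.μ.app N) ≫ n = F.map (F.map f ≫ F.μ.app N ≫ n) ≫ n := by
    have h2 := l.nat f
    have h3 := l.mul_comm N
    simp only [Category.assoc] at hn
    simp only [Category.assoc, F.map_comp]
    rw [← reassoc_of% h2, ← reassoc_of% h3, hn]
  rw [← cancel_epi (l.hom.app X), h1, h1, h]

/-- `λ` is an isomorphism of right modules from the free one on `F X` to the free bimodule on `X`,
and `F.map k ≫ n` is the linear extension of `k` to the former. -/
theorem BDLaw.inv_comp_linear (l : BDLaw F) [∀ X, IsIso (l.hom.app X)] {X N : C}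
    {n : F.obj N ⟶ N} (hn : (l.hom.app N ≫ F.μ.app N) ≫ n = F.map n ≫ n) (k : F.obj X ⟶ N) :
    F.map (inv (l.hom.app X) ≫ F.map k ≫ n) ≫ n =
      (F.η.app (F.obj (F.obj (F.obj X))) ≫ F.map (l.hom.app (F.obj X)) ≫
        F.map (F.map (l.hom.app X ≫ F.μ.app X)) ≫ F.μ.app (F.obj X)) ≫
          inv (l.hom.app X) ≫ F.map k ≫ n := by
  have h1 : F.η.app (F.obj (F.obj (F.obj X))) ≫ F.map (l.hom.app (F.obj X)) =
    l.hom.app (F.obj X) ≫ F.η.app _ := (F.η.naturality (l.hom.app (F.obj X))).symm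
  have h2 : F.η.app (F.obj (F.obj (F.obj X))) ≫ F.map (F.map (l.hom.app X ≫ F.μ.app X)) =
    F.map (l.hom.app X ≫ F.μ.app X) ≫ F.η.app _ :=
      (F.η.naturality (F.map (l.hom.app X ≫ F.μ.app X))).symm
  have h4 := l.yang_baxter X
  have h5 := l.mul_left X
  have h6 := l.nat k
  have h7 : F.μ.app (F.obj X) ≫ F.map k = F.map (F.map k) ≫ F.μ.app N := (F.μ.naturality k).symm
  simp only [Functor.comp_obj, Functor.id_obj, Category.assoc] at hn h1 h2
  rw [← cancel_epi (F.map (l.hom.app X))]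
  simp only [Category.assoc, F.map_comp] at h2 ⊢
  rw [reassoc_of% h1, reassoc_of% h2, F.left_unit_assoc, ← F.map_comp_assoc (l.hom.app X) (inv _),
    IsIso.hom_inv_id, F.map_id, Category.id_comp, reassoc_of% h4, ← reassoc_of% h5,
    IsIso.hom_inv_id_assoc, reassoc_of% h7, ← reassoc_of% h6, hn]

theorem BDLaw.unit_comp_mul (l : BDLaw F) [∀ X, IsIso (l.hom.app X)] {X N : C}
    {n : F.obj N ⟶ N} (k : F.obj X ⟶ N) (g : F.obj (F.obj X) ⟶ F.obj N)
    (hg : F.map (F.map g) ≫ F.map (l.hom.app N) ≫ F.map (F.μ.app N) ≫ F.μ.app N =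
      (F.map (l.hom.app (F.obj X)) ≫ F.map (F.map (l.hom.app X ≫ F.μ.app X)) ≫
        F.μ.app (F.obj X)) ≫ g)
    (hgk : g ≫ n = inv (l.hom.app X) ≫ F.map k ≫ n) (hn : F.η.app N ≫ n = 𝟙 N) :
    F.map (F.η.app X ≫ F.η.app (F.obj X) ≫ g) ≫ F.μ.app N ≫ n = k := by
  have h1 := l.map_comp_mul_of_hom g hg
  have h2 := congrArg F.map (l.unit_left (F.obj X))
  have h3 := congrArg (fun f => F.map (F.map f)) (l.unit_left_mul X)
  have h5 := l.unit_left X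
  have h6 : F.η.app (F.obj X) ≫ F.map k = k ≫ F.η.app N := (F.η.naturality k).symm
  simp only [F.map_comp, F.map_id, Category.assoc, Functor.id_obj] at h1 h2 h3 ⊢
  rw [reassoc_of% h1, reassoc_of% h2, reassoc_of% h3, F.right_unit_assoc, hgk, ← h5]
  simp [reassoc_of% h6, hn]

/-- Test on the free bimodule on `X`: its bilinear maps to `F N` are the maps `X ⟶ F N`, while its
right linear maps to `N` correspond through `λ` to the maps `F X ⟶ N`. -/
theorem BDLaw.HasCofree.of_transpose_bijective {l : BDLaw F} [∀ X, IsIso (l.hom.app X)]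
    (h : ∀ P N, Function.Bijective (transpose l.opposite.adj l.comparisonRestrict P N)) :
    l.HasCofree := by
  rintro N X
  have hN := h (l.enveloping.free.obj X) N
  have ht := fun f => l.transpose_f (P := l.enveloping.free.obj X) (N := N) f
  obtain ⟨N, n, hn, hn'⟩ := N
  change F.obj N ⟶ N at n
  constructor
  · intro f g hfg
    apply (l.enveloping.adj.homEquiv X (l.comparison.obj N)).symm.injective
    apply hN.1
    ext
    refine (ht _).trans (Eq.trans ?_ (ht _).symm)
    have h1 := l.map_mul_comp hn' hfg
    have h2 {Z W : C} (f : Z ⟶ F.obj N) (g : F.obj (F.obj (F.obj N)) ⟶ F.obj N)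
      (n : F.obj N ⟶ W) : (F.map (F.map f) ≫ F.map (F.map (𝟙 _)) ≫ g) ≫ n =
        (F.map (F.map f) ≫ g) ≫ n := by simp
    exact (h2 f _ n).trans (h1.trans (h2 g _ n).symm)
  · intro k
    have h1 := l.inv_comp_linear hn' k
    obtain ⟨⟨g, hg⟩, hgk⟩ := hN.2 ⟨_, h1⟩
    have hgk' := (ht _).symm.trans (congrArg Monad.Algebra.Hom.f hgk)
    exact ⟨_, l.unit_comp_mul k g hg hgk' hn⟩

/-- If the free bimodules `F N` are cofree, `F` is Azumaya if and only if the free functor of the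
opposite monad is comonadic. -/
theorem BDLaw.HasCofree.isAzumaya_iff {l : BDLaw F} (hl : l.HasCofree)
    [∀ X, Epi (l.hom.app X)] : l.IsAzumaya ↔ IsComonadic l.opposite.free :=
  (isComonadic_iff_isEquivalence l.opposite.adj l.comparisonRestrict hl.transpose_bijective
    (isComonadic_algebraFunctor _)).symm

theorem BDLaw.IsAzumaya.hasCofree {l : BDLaw F} [∀ X, IsIso (l.hom.app X)]
    (h : l.IsAzumaya) : l.HasCofree :=
  have : l.comparison.IsEquivalence := h
  .of_transpose_bijective (transpose_bijective_of_isEquivalence _ _)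

end EnvelopingModules

/-! ### Algebras in a braided category: identifying the monads. -/

section LeftModules

variable {V : Type u} [Category.{v} V] [MonoidalCategory V] [BraidedCategory V]

/-- Functor and unit agree definitionally, so equality of the multiplications gives an equality of
monads and not merely an isomorphism. -/
theorem leftMonad_oppositeAlgebra (A : Mon V) :
    leftMonad (oppositeAlgebra A) = (braidingLaw A).opposite := by
  have h : (leftMonad (oppositeAlgebra A)).μ = (braidingLaw A).opposite.μ := by
    ext X
    have h' (m : A.X ⊗ A.X ⟶ A.X) : (α_ A.X A.X X).inv ≫ ((β_ A.X A.X).hom ≫ m) ▷ X =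
        ((α_ A.X A.X X).inv ≫ (β_ A.X A.X).hom ▷ X ≫ (α_ A.X A.X X).hom) ≫
          (α_ A.X A.X X).inv ≫ m ▷ X := by simp
    exact h' _
  have h' {F : V ⥤ V} {e : 𝟭 V ⟶ F} {m m' : F ⋙ F ⟶ F} (hm : m = m') {a b c a' b' c'} :
      (⟨F, e, m, a, b, c⟩ : Monad V) = ⟨F, e, m', a', b', c'⟩ := by
    subst hm
    rfl
  exact h' h

theorem envelopingMonad_mul (A X : V) (m : A ⊗ A ⟶ A) :
    ((α_ (A ⊗ A) (A ⊗ A) X).inv ≫ (tensorμ A A A A ≫ (m ⊗ₘ ((β_ A A).hom ≫ m))) ▷ X) ≫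
        (α_ A A X).hom =
      ((A ⊗ A) ◁ (α_ A A X).hom ≫ (α_ A A (A ⊗ A ⊗ X)).hom) ≫
        A ◁ ((α_ A A (A ⊗ X)).inv ≫ (β_ A A).hom ▷ (A ⊗ X) ≫ (α_ A A (A ⊗ X)).hom) ≫
          A ◁ A ◁ (((α_ A A X).inv ≫ (β_ A A).hom ▷ X ≫ (α_ A A X).hom) ≫
            (α_ A A X).inv ≫ m ▷ X) ≫ (α_ A A (A ⊗ X)).inv ≫ m ▷ (A ⊗ X) := by
  rw [tensorμ, tensorHom_def']
  monoidal

/-- The monad `A^e ⊗ -` is the composite monad. -/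
def envelopingIso (A : Mon V) : leftMonad (envelopingAlgebra A) ≅ (braidingLaw A).enveloping :=
  MonadIso.mk (NatIso.ofComponents (fun X => α_ A.X A.X X) (fun {X Y} f => by
      have h : (A.X ⊗ A.X) ◁ f ≫ (α_ A.X A.X Y).hom = (α_ A.X A.X X).hom ≫ A.X ◁ A.X ◁ f := by
        simp
      exact h))
    (fun X => by
      have h (e : 𝟙_ V ⟶ A.X) : ((λ_ X).inv ≫ ((λ_ (𝟙_ V)).inv ≫ (e ⊗ₘ e)) ▷ X) ≫
          (α_ A.X A.X X).hom =
            ((λ_ X).inv ≫ e ▷ X) ≫ (λ_ (A.X ⊗ X)).inv ≫ e ▷ (A.X ⊗ X) := by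
        rw [tensorHom_def']
        monoidal
      exact h _)
    (fun X => envelopingMonad_mul A.X X _)

theorem envelopingAct_eq (A X : V) (m : A ⊗ A ⟶ A) :
    (α_ (A ⊗ A) A X).inv ≫ ((α_ A A A).hom ≫ A ◁ ((β_ A A).hom ≫ m) ≫ m) ▷ X =
      (α_ A A (A ⊗ X)).hom ≫ A ◁ ((α_ A A X).inv ≫ (β_ A A).hom ▷ X ≫ (α_ A A X).hom) ≫
        A ◁ ((α_ A A X).inv ≫ m ▷ X) ≫ (α_ A A X).inv ≫ m ▷ X := by
  monoidal

theorem isLeftAzumaya_iff_isEquivalence_lift (A : Mon V) :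
    IsLeftAzumaya A ↔ (envelopingModuleFunctor A).lift.IsEquivalence := by
  let J : (braidingLaw A).enveloping.Algebra ⥤ (leftMonad (envelopingAlgebra A)).Algebra :=
    Monad.algebraFunctorOfMonadHom (envelopingIso A).hom
  have : J.IsEquivalence := (Monad.algebraEquivOfIsoMonads (envelopingIso A)).isEquivalence_inverse
  let e : (envelopingModuleFunctor A).lift ≅ (braidingLaw A).comparison ⋙ J :=
    NatIso.ofComponents (fun X => Monad.Algebra.isoMk (Iso.refl (A.X ⊗ X)) (by
      have h {Z : V} (f : Z ⊗ (A.X ⊗ X) ⟶ A.X ⊗ X) : Z ◁ 𝟙 (A.X ⊗ X) ≫ f = f ≫ 𝟙 (A.X ⊗ X) := by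
        simp
      exact (congrArg ((A.X ⊗ A.X) ◁ 𝟙 (A.X ⊗ X) ≫ ·) (envelopingAct_eq A.X X _).symm).trans
        (h ((α_ (A.X ⊗ A.X) A.X X).inv ≫ envelopingAction A ▷ X))))
      (fun {X Y} f => by
        ext
        have h : A.X ◁ f ≫ 𝟙 (A.X ⊗ Y) = 𝟙 (A.X ⊗ X) ≫ A.X ◁ f := by simp
        exact h)
  constructor
  · intro h
    have : (braidingLaw A).comparison.IsEquivalence := h
    exact Functor.isEquivalence_of_iso e.symm
  · intro h
    have := Functor.isEquivalence_of_iso e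
    exact Functor.isEquivalence_of_comp_right (braidingLaw A).comparison J

theorem isLeftAzumaya_iff_isGalois (A : Mon V) :
    IsLeftAzumaya A ↔ IsMonadic (tensorLeft A.X) ∧ (envelopingModuleFunctor A).IsGalois :=
  (isLeftAzumaya_iff_isEquivalence_lift A).trans
    (envelopingModuleFunctor A).isEquivalence_lift_iff

end LeftModules

/-! ### Reduction to free algebras. -/

section FreeAlgebras

variable {C : Type u} [Category.{v} C]

/-- A natural transformation on `T`-algebras between functors that only depend on the underlying
object is invertible as soon as it is invertible on free algebras. -/
theorem isIso_app_of_isIso_app_free {T : Monad C} {G H : C ⥤ C}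
    (θ : T.forget ⋙ G ⟶ T.forget ⋙ H) (hθ : ∀ X, IsIso (θ.app (T.free.obj X))) (N : T.Algebra) :
    IsIso (θ.app N) := by
  let a : T.free.obj N.A ⟶ N := ⟨N.a, N.assoc.symm⟩
  let b : T.free.obj (T.obj N.A) ⟶ T.free.obj N.A := T.free.map N.a
  let c : T.free.obj (T.obj N.A) ⟶ T.free.obj N.A := ⟨T.μ.app N.A, (T.assoc N.A)⟩
  have ha : G.map N.a ≫ θ.app N = θ.app (T.free.obj N.A) ≫ H.map N.a := θ.naturality a
  have hb : G.map (T.map N.a) ≫ θ.app (T.free.obj N.A) =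
    θ.app (T.free.obj (T.obj N.A)) ≫ H.map (T.map N.a) := θ.naturality b
  have hc : G.map (T.μ.app N.A) ≫ θ.app (T.free.obj N.A) =
    θ.app (T.free.obj (T.obj N.A)) ≫ H.map (T.μ.app N.A) := θ.naturality c
  let i (X : C) : G.obj (T.obj X) ≅ H.obj (T.obj X) :=
    @asIso _ _ _ _ (θ.app (T.free.obj X)) (hθ X)
  let t : G.obj N.A ⟶ H.obj N.A := θ.app N
  change G.map N.a ≫ t = (i N.A).hom ≫ H.map N.a at ha
  change G.map (T.map N.a) ≫ (i N.A).hom = (i (T.obj N.A)).hom ≫ H.map (T.map N.a) at hb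
  change G.map (T.μ.app N.A) ≫ (i N.A).hom = (i (T.obj N.A)).hom ≫ H.map (T.μ.app N.A) at hc
  rw [← Iso.inv_comp_eq, ← Category.assoc, ← Iso.eq_comp_inv] at hb hc
  have hl : T.η.app (T.obj N.A) ≫ T.μ.app N.A = 𝟙 (T.obj N.A) := T.left_unit N.A
  have hN : T.μ.app N.A ≫ N.a = T.map N.a ≫ N.a := N.assoc
  -- The unit splits the canonical presentation of `N` by free algebras in `C`, so `G` and `H` both
  -- preserve this presentation, and the inverse below can be written down with `u`.
  obtain ⟨u, hu, hn⟩ : ∃ u : N.A ⟶ T.obj N.A, u ≫ N.a = 𝟙 N.A ∧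
      N.a ≫ u = T.η.app (T.obj N.A) ≫ T.map N.a :=
    ⟨T.η.app N.A, N.unit, T.η.naturality N.a⟩
  have hs : G.map u ≫ G.map N.a = 𝟙 (G.obj N.A) := by rw [← G.map_comp, hu, G.map_id]
  have : Epi (G.map N.a) := ⟨fun f g h => by
    rw [← Category.id_comp f, ← Category.id_comp g, ← hs, Category.assoc, h, Category.assoc]⟩
  refine ⟨H.map u ≫ (i N.A).inv ≫ G.map N.a, ?_, ?_⟩
  · change t ≫ H.map u ≫ (i N.A).inv ≫ G.map N.a = 𝟙 (G.obj N.A)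
    rw [← cancel_epi (G.map N.a), reassoc_of% ha, ← H.map_comp_assoc, hn, H.map_comp_assoc,
      ← reassoc_of% hb, ← G.map_comp, ← hN, G.map_comp, reassoc_of% hc,
      ← H.map_comp_assoc, hl]
    simp
  · change (H.map u ≫ (i N.A).inv ≫ G.map N.a) ≫ t = 𝟙 (H.obj N.A)
    simp only [Category.assoc]
    rw [ha, Iso.inv_hom_id_assoc, ← H.map_comp, hu, H.map_id]

end FreeAlgebras

/-! ### Right duals: cofreeness is invertibility of `χ`. -/

section RightDual

variable {V : Type u} [Category.{v} V] [MonoidalCategory V]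

/-- The mate `A ⊗ N ⟶ A♯ ⊗ N` of `A ⊗ A ⊗ N ⟶ A ⊗ N ⟶ N`. -/
def mulMate {A Asharp : V} [ExactPairing Asharp A] (m : A ⊗ A ⟶ A) {N : V} (n : A ⊗ N ⟶ N) :
    A ⊗ N ⟶ Asharp ⊗ N :=
  tensorLeftHomEquiv (A ⊗ N) Asharp A N ((α_ A A N).inv ≫ m ▷ N ≫ n)

theorem mulMate_naturality {A Asharp : V} [ExactPairing Asharp A] (m : A ⊗ A ⟶ A) {N N' : V}
    {n : A ⊗ N ⟶ N} {n' : A ⊗ N' ⟶ N'} (k : N ⟶ N') (h : A ◁ k ≫ n' = n ≫ k) :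
    A ◁ k ≫ mulMate m n' = mulMate (Asharp := Asharp) m n ≫ Asharp ◁ k := by
  rw [mulMate, mulMate, ← tensorLeftHomEquiv_naturality]
  apply (tensorLeftHomEquiv _ Asharp A N').symm.injective
  rw [tensorLeftHomEquiv_symm_naturality, Equiv.symm_apply_apply, Equiv.symm_apply_apply]
  simp only [Category.assoc, ← h, ← whisker_exchange_assoc]
  simp

theorem mulMate_free {A Asharp : V} [ExactPairing Asharp A] (m n : A ⊗ A ⟶ A) (X : V) :
    mulMate (Asharp := Asharp) m ((α_ A A X).inv ≫ n ▷ X) =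
      (α_ A A X).inv ≫ mulMate m n ▷ X ≫ (α_ Asharp A X).hom := by
  simp only [mulMate, tensorLeftHomEquiv, Equiv.coe_fn_mk]
  monoidal

/-- Duality identifies `Hom(A ⊗ X, N)` with `Hom(X, A♯ ⊗ N)`, which turns the displayed map into
composition with the mate; then apply Yoneda. -/
theorem isIso_mulMate_iff {A Asharp : V} [ExactPairing Asharp A] (m : A ⊗ A ⟶ A) {N : V}
    (n : A ⊗ N ⟶ N) : IsIso (mulMate (Asharp := Asharp) m n) ↔ ∀ X : V, Function.Bijective
      fun f : X ⟶ A ⊗ N => A ◁ f ≫ ((α_ A A N).inv ≫ m ▷ N) ≫ n := by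
  have h (X : V) : (fun f : X ⟶ A ⊗ N => A ◁ f ≫ ((α_ A A N).inv ≫ m ▷ N) ≫ n) =
      (tensorLeftHomEquiv X Asharp A N).symm ∘ fun f => f ≫ mulMate m n := by
    funext f
    rw [Function.comp_apply, tensorLeftHomEquiv_symm_naturality, mulMate, Equiv.symm_apply_apply,
      Category.assoc]
  rw [isIso_iff_yoneda_map_bijective]
  refine forall_congr' fun X => ?_
  rw [h, Equiv.comp_bijective]

variable [BraidedCategory V]

theorem chi_eq_mulMate (A : Mon V) (Asharp : V) [ExactPairing Asharp A.X] :
    chi A Asharp = mulMate (MonObj.mul (X := A.X)) ((β_ A.X A.X).hom ≫ MonObj.mul (X := A.X)) := by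
  simp only [chi, mulMate, tensorLeftHomEquiv, Equiv.coe_fn_mk, whiskerLeft_comp]

/-- The mates of the multiplication, as a natural transformation on right modules. -/
def mulMateTrans (A : Mon V) (Asharp : V) [ExactPairing Asharp A.X] :
    (braidingLaw A).opposite.forget ⋙ tensorLeft A.X ⟶
      (braidingLaw A).opposite.forget ⋙ tensorLeft Asharp where
  app N := mulMate (N := N.A) (MonObj.mul (X := A.X)) N.a
  naturality _ _ f := mulMate_naturality _ f.f f.h

/-- Cofreeness is invertibility of the mate at every module. On the free module on `X` the mate is
`χ ⊗ X` up to associators, and the free module on `I` returns `χ` itself. -/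
theorem hasCofree_iff_isIso_chi (A : Mon V) (Asharp : V) [ExactPairing Asharp A.X] :
    (braidingLaw A).HasCofree ↔ IsIso (chi A Asharp) := by
  have h : (braidingLaw A).HasCofree ↔ ∀ N, IsIso ((mulMateTrans A Asharp).app N) :=
    forall_congr' fun N => (isIso_mulMate_iff (MonObj.mul (X := A.X)) (N := N.A) N.a).symm
  have hX (X : V) : (mulMateTrans A Asharp).app ((braidingLaw A).opposite.free.obj X) =
      (α_ A.X A.X X).inv ≫ chi A Asharp ▷ X ≫ (α_ Asharp A.X X).hom := by
    rw [chi_eq_mulMate, ← mulMate_free]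
    have h' : ((α_ A.X A.X X).inv ≫ (β_ A.X A.X).hom ▷ X ≫ (α_ A.X A.X X).hom) ≫
        (α_ A.X A.X X).inv ≫ MonObj.mul (X := A.X) ▷ X = (α_ A.X A.X X).inv ≫
          ((β_ A.X A.X).hom ≫ MonObj.mul (X := A.X)) ▷ X := by simp
    exact congrArg (mulMate (N := A.X ⊗ X) (Asharp := Asharp) (MonObj.mul (X := A.X))) h'
  rw [h]
  constructor
  · intro hN
    have h1 : IsIso ((α_ A.X A.X (𝟙_ V)).inv ≫ chi A Asharp ▷ 𝟙_ V ≫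
        (α_ Asharp A.X (𝟙_ V)).hom) := by
      have h1 := hN ((braidingLaw A).opposite.free.obj (𝟙_ V))
      rw [hX] at h1
      exact h1
    have h2 : chi A Asharp = (ρ_ _).inv ≫ (α_ A.X A.X (𝟙_ V)).hom ≫ ((α_ A.X A.X (𝟙_ V)).inv ≫
        chi A Asharp ▷ 𝟙_ V ≫ (α_ Asharp A.X (𝟙_ V)).hom) ≫ (α_ Asharp A.X (𝟙_ V)).inv ≫
          (ρ_ _).hom := by simp
    rw [h2]
    infer_instance
  · intro _
    refine isIso_app_of_isIso_app_free _ fun X => ?_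
    rw [hX]
    exact inferInstanceAs (IsIso ((α_ A.X A.X X).inv ≫ chi A Asharp ▷ X ≫ (α_ Asharp A.X X).hom))

end RightDual

/-! ### Left duals: the Galois map and `χ₀`. -/

section LeftDual

variable {V : Type u} [Category.{v} V] [MonoidalCategory V]

/-- For an action `r : B ⊗ A ⟶ A` and `db : I ⟶ A ⊗ D`, the morphism `B ⟶ A ⊗ D`. -/
def actMate {A B D : V} (r : B ⊗ A ⟶ A) (db : 𝟙_ V ⟶ A ⊗ D) : B ⟶ A ⊗ D :=
  (ρ_ B).inv ≫ B ◁ db ≫ (α_ B A D).inv ≫ r ▷ D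

/-- This is what identifies Galois maps at a general `X` with the one at `I` tensored with `X`. -/
theorem actMate_whiskerRight {A B D : V} (r : B ⊗ A ⟶ A) (db : 𝟙_ V ⟶ A ⊗ D) (X : V) :
    B ◁ ((λ_ X).inv ≫ db ▷ X ≫ (α_ A D X).hom) ≫ (α_ B A (D ⊗ X)).inv ≫ r ▷ (D ⊗ X) =
      actMate r db ▷ X ≫ (α_ A D X).hom := by
  rw [actMate]
  monoidal

theorem one_actMate {A B D : V} {r : B ⊗ A ⟶ A} (db : 𝟙_ V ⟶ A ⊗ D) {e : 𝟙_ V ⟶ B}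
    (he : e ▷ A ≫ r = (λ_ A).hom) : e ≫ actMate r db = db := by
  calc _ = 𝟙 _ ⊗≫ (e ▷ 𝟙_ V ≫ B ◁ db) ⊗≫ r ▷ D := by rw [actMate]; monoidal
    _ = db ⊗≫ (e ▷ A ≫ r) ▷ D := by rw [← whisker_exchange]; monoidal
    _ = _ := by rw [he]; monoidal

/-- `A ⊗ D` plays the role of the endomorphism algebra of `A`, so transposing an associative action
gives a multiplicative map. The evaluation cancels one coevaluation by a triangle identity. -/
theorem mul_actMate {A B D : V} [ExactPairing A D] {r : B ⊗ A ⟶ A} {m : B ⊗ B ⟶ B}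
    (hm : m ▷ A ≫ r = (α_ B B A).hom ≫ B ◁ r ≫ r) :
    m ≫ actMate r (η_ A D) = (actMate r (η_ A D) ⊗ₘ actMate r (η_ A D)) ≫
      (α_ A D (A ⊗ D)).hom ≫ A ◁ (α_ D A D).inv ≫ A ◁ (ε_ A D ▷ D) ≫ A ◁ (λ_ D).hom := by
  symm
  calc _ = 𝟙 _ ⊗≫ B ◁ actMate r (η_ A D) ⊗≫ B ◁ (η_ A D ▷ (A ⊗ D)) ⊗≫
          (r ▷ (D ⊗ A) ≫ A ◁ ε_ A D) ▷ D ⊗≫ 𝟙 _ := by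
        rw [tensorHom_def']
        nth_rw 2 [actMate]
        monoidal
    _ = 𝟙 _ ⊗≫ B ◁ actMate r (η_ A D) ⊗≫
          B ◁ (η_ A D ▷ A ≫ (α_ A D A).hom ≫ A ◁ ε_ A D) ▷ D ⊗≫ r ▷ D ⊗≫ 𝟙 _ := by
        rw [← whisker_exchange]
        monoidal
    _ = 𝟙 _ ⊗≫ (B ⊗ B) ◁ η_ A D ⊗≫ ((α_ B B A).hom ≫ B ◁ r ≫ r) ▷ D ⊗≫ 𝟙 _ := by
        rw [ExactPairing.evaluation_coevaluation, actMate]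
        monoidal
    _ = 𝟙 _ ⊗≫ ((B ⊗ B) ◁ η_ A D ≫ m ▷ (A ⊗ D)) ⊗≫ r ▷ D ⊗≫ 𝟙 _ := by
        rw [← hm]
        monoidal
    _ = _ := by
        rw [whisker_exchange, actMate]
        monoidal

/-- A morphism `db : I ⟶ A ⊗ D` that induces bijections `Hom(D ⊗ X, Y) ≅ Hom(X, A ⊗ Y)` is the
unit of a duality. -/
theorem exists_exactPairing {A D : V} (db : 𝟙_ V ⟶ A ⊗ D)
    (h : ∀ X Y : V, Function.Bijective fun f : D ⊗ X ⟶ Y =>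
      (λ_ X).inv ≫ db ▷ X ≫ (α_ A D X).hom ≫ A ◁ f) :
    ∃ _ : ExactPairing A D, η_ A D = db := by
  -- Choosing `ev` as the preimage of `(ρ_ A).inv` is one triangle identity; the other follows from
  -- injectivity.
  obtain ⟨ev, hev⟩ := (h A (𝟙_ V)).2 (ρ_ A).inv
  dsimp only at hev
  have h1 : db ▷ A ≫ (α_ A D A).hom ≫ A ◁ ev = (λ_ A).hom ≫ (ρ_ A).inv := by
    rw [← hev, Iso.hom_inv_id_assoc]
  have h2 : (ρ_ D).hom ≫ (ρ_ D).inv ≫ D ◁ db ≫ (α_ D A D).inv ≫ ev ▷ D ≫ (λ_ D).hom =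
      (ρ_ D).hom := by
    apply (h _ _).1
    dsimp only
    calc _ = 𝟙 _ ⊗≫ (db ▷ 𝟙_ V ≫ (A ⊗ D) ◁ db) ⊗≫ A ◁ (ev ▷ D) ⊗≫ 𝟙 _ := by monoidal
      _ = 𝟙 _ ⊗≫ db ⊗≫ (db ▷ A ≫ (α_ A D A).hom ≫ A ◁ ev) ▷ D ⊗≫ 𝟙 _ := by
        rw [← whisker_exchange]
        monoidal
      _ = _ := by
        rw [h1]
        monoidal
  refine ⟨⟨db, ev, ?_, h1⟩, rfl⟩
  rw [Iso.hom_inv_id_assoc] at h2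
  rw [← h2]
  simp

/-- A left adjoint of `A ⊗ -` which is compatible with tensor products is given by a left dual. -/
theorem exists_exactPairing_of_adjunction {A : V} {L : V ⥤ V} (adj : L ⊣ tensorLeft A)
    (h : ∀ X, IsIso ((adj.homEquiv X (L.obj (𝟙_ V) ⊗ X)).symm
      ((λ_ X).inv ≫ adj.unit.app (𝟙_ V) ▷ X ≫ (α_ A (L.obj (𝟙_ V)) X).hom))) :
    ∃ _ : ExactPairing A (L.obj (𝟙_ V)), η_ A (L.obj (𝟙_ V)) = adj.unit.app (𝟙_ V) := by
  refine exists_exactPairing (D := L.obj (𝟙_ V)) (adj.unit.app (𝟙_ V)) fun X Y => ?_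
  have := h X
  have h' : (fun f : L.obj (𝟙_ V) ⊗ X ⟶ Y => (λ_ X).inv ≫ adj.unit.app (𝟙_ V) ▷ X ≫
      (α_ A (L.obj (𝟙_ V)) X).hom ≫ A ◁ f) = fun f => adj.homEquiv X Y
        ((asIso ((adj.homEquiv X (L.obj (𝟙_ V) ⊗ X)).symm ((λ_ X).inv ≫
          adj.unit.app (𝟙_ V) ▷ X ≫ (α_ A (L.obj (𝟙_ V)) X).hom))).symm.homCongr (Iso.refl Y) f) := by
    funext f
    have hk {Z : V} (g : X ⟶ A ⊗ Z) (k : Z ⟶ Y) :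
        adj.homEquiv X Y ((adj.homEquiv X Z).symm g ≫ k) = g ≫ A ◁ k :=
      (adj.homEquiv_naturality_right _ k).trans
        (congrArg (· ≫ A ◁ k) ((adj.homEquiv X Z).apply_symm_apply g))
    rw [Iso.homCongr_apply, Iso.symm_inv, Iso.refl_hom, Category.comp_id, asIso_hom, hk]
    simp only [Category.assoc]
  rw [h']
  exact (adj.homEquiv X Y).bijective.comp (Equiv.bijective _)

theorem reflectsIsomorphisms_of_isMonadic {C : Type u} [Category.{v} C] {D : Type u'}
    [Category.{v'} D] {R : D ⥤ C} (h : IsMonadic R) : R.ReflectsIsomorphisms := by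
  obtain ⟨⟨L, adj, _⟩⟩ := h
  exact inferInstanceAs (Monad.comparison adj ⋙ adj.toMonad.forget).ReflectsIsomorphisms

variable [BraidedCategory V]

/-- The two sides bracket the triple product differently, so associativity of `A` is all that is
used beyond coherence. -/
theorem chiZero_eq_actMate (A : Mon V) (Astar : V) [ExactPairing A.X Astar] :
    chiZero A Astar = actMate (envelopingAction A) (η_ A.X Astar) := by
  have h := MonObj.mul_assoc A.X
  symm
  calc _ = 𝟙 _ ⊗≫ (A.X ⊗ A.X) ◁ η_ A.X Astar ⊗≫ A.X ◁ ((β_ A.X A.X).hom ▷ Astar) ⊗≫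
          ((α_ A.X A.X A.X).hom ≫ A.X ◁ MonObj.mul (X := A.X) ≫ MonObj.mul (X := A.X)) ▷ Astar := by
        rw [actMate, envelopingAction]
        monoidal
    _ = _ := by
        rw [← h, chiZero]
        monoidal

theorem toAdjunctionMonad_app_comp (A : Mon V) {L : V ⥤ V} (adj : L ⊣ tensorLeft A.X) {X Y : V}
    (c : L.obj X ⟶ Y) :
    ((envelopingModuleFunctor A).toAdjunctionMonad adj).app X ≫ A.X ◁ c =
      (A.X ⊗ A.X) ◁ adj.homEquiv X Y c ≫
        (α_ (A.X ⊗ A.X) A.X Y).inv ≫ envelopingAction A ▷ Y := by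
  have h {Z W : V} (f : X ⟶ A.X ⊗ Z) (c : Z ⟶ W) :
      ((A.X ⊗ A.X) ◁ f ≫ (α_ (A.X ⊗ A.X) A.X Z).inv ≫ envelopingAction A ▷ Z) ≫ A.X ◁ c =
        (A.X ⊗ A.X) ◁ (f ≫ A.X ◁ c) ≫
          (α_ (A.X ⊗ A.X) A.X W).inv ≫ envelopingAction A ▷ W := by
    simp only [Category.assoc, ← whisker_exchange, whiskerLeft_comp]
    simp
  rw [Adjunction.homEquiv_unit]
  exact h _ c

theorem isIso_actMate (A : Mon V) {L : V ⥤ V} (adj : L ⊣ tensorLeft A.X)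
    [IsIso ((envelopingModuleFunctor A).toAdjunctionMonad adj)] :
    IsIso (actMate (envelopingAction A) (adj.unit.app (𝟙_ V))) := by
  have h : actMate (envelopingAction A) (adj.unit.app (𝟙_ V)) =
      (ρ_ (A.X ⊗ A.X)).inv ≫ ((envelopingModuleFunctor A).toAdjunctionMonad adj).app (𝟙_ V) := rfl
  rw [h]
  exact @IsIso.comp_isIso _ _ _ _ _ _ _ inferInstance
    ((NatTrans.isIso_iff_isIso_app _).1 inferInstance (𝟙_ V))

/-- If `A ⊗ -` is monadic and Galois, then `A` has a left dual such that `χ₀` is invertible. -/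
theorem exists_isIso_chiZero (A : Mon V) (hA : IsMonadic (tensorLeft A.X))
    (h : (envelopingModuleFunctor A).IsGalois) :
    ∃ (Astar : V) (_ : ExactPairing A.X Astar), IsIso (chiZero A Astar) := by
  obtain ⟨L, adj, _⟩ := h
  have hi := isIso_actMate A adj
  have := reflectsIsomorphisms_of_isMonadic hA
  obtain ⟨p, hp⟩ := exists_exactPairing_of_adjunction adj fun X => by
    -- The canonical comparison `L X ⟶ L I ⊗ X`. The Galois map at `X` followed by `A ⊗ c` is `χ₀ ⊗
    -- X` up to an associator, so `A ⊗ c` is invertible, and then so is `c`.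
    set c := (adj.homEquiv X (L.obj (𝟙_ V) ⊗ X)).symm
      ((λ_ X).inv ≫ adj.unit.app (𝟙_ V) ▷ X ≫ (α_ A.X (L.obj (𝟙_ V)) X).hom) with hc
    have h1 := toAdjunctionMonad_app_comp A adj c
    rw [hc, Equiv.apply_symm_apply, ← hc] at h1
    have h2 := h1.trans (actMate_whiskerRight (envelopingAction A) (adj.unit.app (𝟙_ V)) X)
    have h3 : IsIso (actMate (envelopingAction A) (adj.unit.app (𝟙_ V)) ▷ X ≫
        (α_ A.X (L.obj (𝟙_ V)) X).hom) :=
      @IsIso.comp_isIso _ _ _ _ _ _ _ (MonoidalCategory.whiskerRight_isIso _ X) inferInstance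
    rw [← h2] at h3
    have : IsIso ((tensorLeft A.X).map c) := @IsIso.of_isIso_comp_left _ _ _ _ _
      (((envelopingModuleFunctor A).toAdjunctionMonad adj).app X) (A.X ◁ c) inferInstance h3
    exact isIso_of_reflects_iso c (tensorLeft A.X)
  refine ⟨_, p, ?_⟩
  rw [chiZero_eq_actMate, hp]
  exact hi

/-- With `A* ⊗ -` as left adjoint, the Galois map at `X` is `χ₀ ⊗ X` up to an associator. -/
theorem isGalois_of_isIso_chiZero (A : Mon V) (Astar : V) [ExactPairing A.X Astar]
    [IsIso (chiZero A Astar)] : (envelopingModuleFunctor A).IsGalois := by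
  refine ⟨_, tensorLeftAdjunction A.X Astar, ?_⟩
  rw [NatTrans.isIso_iff_isIso_app]
  intro X
  have h := toAdjunctionMonad_app_comp A (tensorLeftAdjunction A.X Astar) (𝟙 (Astar ⊗ X))
  have h' : (tensorLeftAdjunction A.X Astar).homEquiv X (Astar ⊗ X) (𝟙 (Astar ⊗ X)) =
      (λ_ X).inv ≫ η_ A.X Astar ▷ X ≫ (α_ A.X Astar X).hom := by
    simp [tensorLeftAdjunction, tensorLeftHomEquiv]
  rw [h', actMate_whiskerRight, ← chiZero_eq_actMate] at h
  have h2 := (Category.comp_id _).symm.trans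
    ((congrArg (_ ≫ ·) (MonoidalCategory.whiskerLeft_id A.X (Astar ⊗ X)).symm).trans h)
  rw [h2]
  exact inferInstanceAs (IsIso (chiZero A Astar ▷ X ≫ (α_ A.X Astar X).hom))

/-- If `χ₀` is invertible, it is an isomorphism of algebras. -/
theorem exists_iso_dualAlgebra (A : Mon V) (Astar : V) [ExactPairing A.X Astar]
    [IsIso (chiZero A Astar)] :
    ∃ i : envelopingAlgebra A ≅ dualAlgebra A.X Astar, i.hom.hom = chiZero A Astar := by
  let i : A.X ⊗ A.X ≅ A.X ⊗ Astar := asIso (chiZero A Astar)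
  have hi : i.hom = actMate (envelopingAction A) (η_ A.X Astar) := chiZero_eq_actMate A Astar
  refine ⟨Mon.mkIso (M := envelopingAlgebra A) (N := dualAlgebra A.X Astar) i ?_ ?_, rfl⟩
  · rw [hi]
    exact one_actMate (η_ A.X Astar) (envelopingAction_unit A.X _ _ _ (MonObj.one_mul A.X)
      (MonObj.one_mul (oppositeAlgebra A).X))
  · rw [hi]
    have h := envelopingAction_assoc A.X (MonObj.mul (X := A.X))
      ((β_ A.X A.X).hom ≫ MonObj.mul (X := A.X)) (MonObj.mul_assoc_flip A.X)
      (MonObj.mul_assoc_flip (oppositeAlgebra A).X) (by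
        rw [← Category.assoc (A.X ◁ _), mul_braiding_right]
        simp only [Category.assoc, MonObj.mul_assoc, Iso.inv_hom_id_assoc, whiskerLeft_comp])
    exact mul_actMate h

end LeftDual

end AzumayaCat

theorem mainTheorem9 {V : Type u} [Category.{v} V] [MonoidalCategory V] [BraidedCategory V]
    (A : Mon V) :
    List.TFAE
      [ AzumayaCat.IsLeftAzumaya A,
        AzumayaCat.IsMonadic (tensorLeft A.X) ∧ (AzumayaCat.envelopingModuleFunctor A).IsGalois,
        AzumayaCat.IsMonadic (tensorLeft A.X) ∧
          ∃ (Astar : V) (_ : ExactPairing A.X Astar)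
            (i : AzumayaCat.envelopingAlgebra A ≅ AzumayaCat.dualAlgebra A.X Astar),
            i.hom.hom = AzumayaCat.chiZero A Astar,
        AzumayaCat.IsComonadic (AzumayaCat.leftMonad (AzumayaCat.oppositeAlgebra A)).free ∧
          ∃ (Asharp : V) (_ : ExactPairing Asharp A.X),
            IsIso (AzumayaCat.chi A Asharp) ] := by
  have hβ (X : V) : IsIso ((AzumayaCat.braidingLaw A).hom.app X) :=
    inferInstanceAs (IsIso ((α_ A.X A.X X).inv ≫ (β_ A.X A.X).hom ▷ X ≫ (α_ A.X A.X X).hom))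
  tfae_have 1 ↔ 2 := AzumayaCat.isLeftAzumaya_iff_isGalois A
  tfae_have 2 → 3 := by
    rintro ⟨h₁, h₂⟩
    obtain ⟨Astar, _, _⟩ := AzumayaCat.exists_isIso_chiZero A h₁ h₂
    exact ⟨h₁, Astar, inferInstance, AzumayaCat.exists_iso_dualAlgebra A Astar⟩
  tfae_have 3 → 2 := by
    rintro ⟨h₁, Astar, _, i, hi⟩
    have : IsIso (AzumayaCat.chiZero A Astar) := hi ▸ inferInstanceAs (IsIso i.hom.hom)
    exact ⟨h₁, AzumayaCat.isGalois_of_isIso_chiZero A Astar⟩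
  tfae_have 1 → 4 := by
    intro h
    have h₁ := AzumayaCat.BDLaw.IsAzumaya.hasCofree h
    obtain ⟨-, Astar, _, -⟩ := tfae_2_to_3 (tfae_1_iff_2.1 h)
    -- The left dual obtained through (c) becomes a right dual by means of the braiding.
    let _ : ExactPairing Astar A.X := BraidedCategory.exactPairing_swap A.X Astar
    rw [AzumayaCat.leftMonad_oppositeAlgebra]
    exact ⟨h₁.isAzumaya_iff.1 h, Astar, inferInstance,
      (AzumayaCat.hasCofree_iff_isIso_chi A Astar).1 h₁⟩
  tfae_have 4 → 1 := by
    rw [AzumayaCat.leftMonad_oppositeAlgebra]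
    rintro ⟨h, Asharp, _, hχ⟩
    exact ((AzumayaCat.hasCofree_iff_isIso_chi A Asharp).2 hχ).isAzumaya_iff.2 h
  tfae_finish
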